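/- **Setting.** Let $\bar A\in\mathbb R^{d\times d}$, $\bar B\in\mathbb R^{d\times m}$, let $\mathcal P_A=\mathrm{conv}\{\Delta_A^{(1)},\dots,\Delta_A^{(n_a)}\}$ and $\mathcal P_B=\mathrm{conv}\{\Delta_B^{(1)},\dots,\Delta_B^{(n_b)}\}$ be sets of matrices of the same sizes, and let $\mathcal X=\{x: H^xx\le h^x\}$, $\mathcal U=\{u:H^uu\le h^u\}$, $\mathbb W=\{w:H^ww\le h^w\}$, $\mathcal X_N=\{x:H^x_Nx\le h^x_N\}$. The system is $x_{t+1}=Ax_t+Bu_t+w_t$ with $w_t\in\mathbb W$, $A=\bar A+\Delta_A^{\rm tr}$, $B=\bar B+\Delta_B^{\rm tr}$, for some fixed $\Delta_A^{\rm tr}\in\mathcal P_A$, $\Delta_B^{\rm tr}\in\mathcal P_B$. Let $\|\cdot\|$ be a $p$-norm, $1\le p\le\infty$, of vectors, $\|\cdot\|_*$ its dual norm, $\|\cdot\|_p$ the induced matrix norm. **MPC problem of horizon $n\ge1$ at the state $x$.** The decision variables are nominal inputs $\bar u_0,\dots,\bar u_{n-1}$, nominal states $\bar x_0=x$, $\bar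 x_{k+1}=\bar A\bar x_k+\bar B\bar u_k$, and a strictly block lower triangular $\mathbf M=(M_{k,l})_{0\le l<k<n}$, $M_{k,l}\in\mathbb R^{m\times d}$. Write $\bar{\mathbf x}=(\bar x_0,\dots,\bar x_{n-1})$, $\bar{\mathbf u}=(\bar u_0,\dots,\bar u_{n-1})$. The cost to be minimized is $\sum_{k<n}(\bar x_k^\top P\bar x_k+\bar u_k^\top R\bar u_k)+\bar x_n^\top P_N\bar x_n$, and its optimal value is $V_n(x)$. The constraints are: each block of $\mathbf M\mathbf w+\bar{\mathbf u}$ lies in $\mathcal U$ for all $\mathbf w\in\mathbb W^n$; if $n=1$, $(\bar A+\Delta_A)\bar x_0+(\bar B+\Delta_B)\bar u_0+w\in\mathcal X_N$ for all $w\in\mathbb W$, $\Delta_A\in\mathcal P_A$, $\Delta_B\in\mathcal P_B$; if $n\ge2$, for every row $i$ and all $\mathbf w\in\mathbb W^n$, $$\mathbf F_i\big(\bar{\mathbf A}\bar{\mathbf x}+\bar{\mathbf B}(\mathbf M\mathbf w+\bar{\mathbf u})+(\bar{\mathbf A}_1-I)\bar{\mathbf B}\mathbf M\mathbf w+\mathbf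 w\big)\le \mathbf f_i-(t_{\delta A}^i+t_1^i)\|\bar{\mathbf x}\|-(t_{\delta B}^i+t_2^i+t_3^i)\|\mathbf M\|_p\mathbf w_{\max}-(t_{\delta B}^i+t_2^i)\|\bar{\mathbf u}\|-t_w^i\mathbf w_{\max}.$$ Here $\mathbf F=\mathrm{diag}(I_{n-1}\otimes H^x,H^x_N)$, $\mathbf f=(h^x,\dots,h^x,h^x_N)$, $\bar{\mathbf A}=I_n\otimes\bar A$, $\bar{\mathbf B}=I_n\otimes\bar B$, $\bar{\mathbf A}_1$ is block lower triangular with blocks $\bar A^{k-l}$ $(l\le k)$, and $\mathbf w_{\max}$ (which may depend on $n$) satisfies $\|\mathbf w\|\le\mathbf w_{\max}$ for all $\mathbf w\in\mathbb W^n$, $n\le N$. For matrices $\Delta_1,\dots,\Delta_{n-1}$ let $\mathbf T(\Delta_1,\dots,\Delta_{n-1})$ be the strictly block lower triangular matrix with blocks $\Delta_{k-l}$ $(l<k)$. With $\Delta_j$ ranging over the convex hull of all products of $j$ of the matrices $\bar A+\Delta_A^{(q)}$, put $t_0^i=\max\|\mathbf F_i\mathbf T(\Delta_1-\bar A,\dots,\Delta_{n-1}-\bar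 A^{n-1})\|_*$ and $t_w^i=\max\|\mathbf F_i\mathbf T(\Delta_1,\dots,\Delta_{n-1})\|_*$. Further $t_1^i=t_0^i\max_{\Delta_A\in\mathcal P_A}\|I_n\otimes\Delta_A\|_p$, $t_2^i=t_0^i\max_{\Delta_B\in\mathcal P_B}\|I_n\otimes\Delta_B\|_p$, $t_3^i=t_0^i\|\bar{\mathbf B}\|_p$, $t_{\delta A}^i=\max_{\Delta_A\in\mathcal P_A}\|\mathbf F_i\bar{\mathbf A}_1(I_n\otimes\Delta_A)\|_*$, $t_{\delta B}^i=\max_{\Delta_B\in\mathcal P_B}\|\mathbf F_i\bar{\mathbf A}_1(I_n\otimes\Delta_B)\|_*$. **Closed loop.** Let $N\ge1$, and $N_t=N-t$ for $0\le t\le N-2$, $N_t=1$ for $t\ge N-1$. At time $t$, if the MPC problem of horizon $N_t$ is feasible at $x_t$, an optimal solution is computed and $u_t=\bar u_0$ is applied. Otherwise the plan computed at the latest earlier time $t_{\rm f}$ at which the problem was feasible is continued: $u_t=\bar u_{k}+\sum_{l<k}M_{k,l}w_{t_{\rm f}+l}$ with $k=t-t_{\rm f}$. Put $\tilde w_t=\Delta_A^{\rm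 tr}x_t+\Delta_B^{\rm tr}u_t+w_t$. **Assumptions.** (1) $\bar A+\Delta_A+(\bar B+\Delta_B)K$ is Schur stable for all $\Delta_A\in\mathcal P_A$, $\Delta_B\in\mathcal P_B$, and $\mathcal X_N$ is the largest subset $S$ of $\{x\in\mathcal X:Kx\in\mathcal U\}$ such that $(\bar A+\Delta_A+(\bar B+\Delta_B)K)x+w\in S$ for all $x\in S$, $\Delta_A\in\mathcal P_A$, $\Delta_B\in\mathcal P_B$, $w\in\mathbb W$. (2) $\mathcal X,\mathcal U,\mathbb W$ are compact and contain the origin in their interiors. (3) $P\succ0$, $R\succ0$. (4) $P_N\succ0$ and $x^\top(-P_N+P+K^\top RK+(\bar A+\bar BK)^\top P_N(\bar A+\bar BK))x\le0$ for all $x\in\mathcal X_N$. **Theorem.** Let the MPC problem of horizon $N$ be feasible at $x_0$. Then every closed-loop trajectory from $x_0$ satisfies $x_t\in\mathcal X_N$ for all $t\ge N$. Moreover, the origin of the closed loop is input-to-state stable in $\mathcal X_N$ once the horizon has shrunk to one, and $V_1$ is an ISS Lyapunov function. That is: * $V_1\ge0$ is continuous on $\mathcal X_N$, and there are class-$\mathcal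 K_\infty$ functions $\alpha_1,\alpha_2,\alpha_3$ and a class-$\mathcal K$ function $\sigma$ with $\alpha_1(\|x\|)\le V_1(x)\le\alpha_2(\|x\|)$ for all $x\in\mathcal X_N$, such that for every closed loop running from a time $s\ge N-1$ with arbitrary $x_s\in\mathcal X_N$ and all $t\ge s$, $V_1(x_{t+1})-V_1(x_t)\le-\alpha_3(\|x_t\|)+\sigma(\max_{s\le i\le t}\|\tilde w_i\|)$; * there are a class-$\mathcal{KL}$ function $\beta$ and a class-$\mathcal K$ function $\gamma$ such that for all such closed loops and all $t\ge s$, $\|x_{t+1}\|\le\beta(\|x_s\|,t-s+1)+\gamma(\max_{s\le i\le t}\|\tilde w_i\|)$. In particular both apply, with $s=N$, to the trajectories from $x_0$. -/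

import Mathlib

open scoped Matrix Kronecker ENNReal

noncomputable section

/-! ### Norms and comparison functions -/

/-- The `p`-norm of a real vector. -/
def vnorm (p : ℝ≥0∞) {ι : Type} [Fintype ι] (v : ι → ℝ) : ℝ := ‖WithLp.toLp p v‖

/-- The dual norm `‖v‖_* = sup_{‖y‖ ≤ 1} yᵀ v` of the `p`-norm. -/
def dualNorm (p : ℝ≥0∞) {ι : Type} [Fintype ι] (v : ι → ℝ) : ℝ :=
  sSup {c | ∃ y : ι → ℝ, vnorm p y ≤ 1 ∧ c = y ⬝ᵥ v}

/-- The induced `p`-norm of a matrix (operator norm of `x ↦ A x` for the `p`-norms). -/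
def inducedNorm (p : ℝ≥0∞) [Fact (1 ≤ p)] {ι κ : Type} [Fintype ι] [Fintype κ] [DecidableEq κ]
    (A : Matrix ι κ ℝ) : ℝ :=
  ‖(Matrix.toLpLin p p A).toContinuousLinearMap‖

/-- The maximum of `f` over `S`; only used for continuous functions on nonempty compact sets. -/
def maxOver {α : Type} (S : Set α) (f : α → ℝ) : ℝ := sSup (f '' S)

/-- Class-`K` functions on `[0, ∞)`. -/
def IsClassK (α : ℝ → ℝ) : Prop :=
  ContinuousOn α (Set.Ici 0) ∧ StrictMonoOn α (Set.Ici 0) ∧ α 0 = 0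

/-- Class-`K∞` functions. -/
def IsClassKInf (α : ℝ → ℝ) : Prop :=
  IsClassK α ∧ Filter.Tendsto α Filter.atTop Filter.atTop

/-- Class-`KL` functions on `[0, ∞) × [0, ∞)`. -/
def IsClassKL (β : ℝ → ℝ → ℝ) : Prop :=
  ContinuousOn (Function.uncurry β) (Set.Ici 0 ×ˢ Set.Ici 0) ∧
  (∀ s, 0 ≤ s → IsClassK fun r => β r s) ∧
  ∀ r, 0 ≤ r → AntitoneOn (β r) (Set.Ici 0) ∧
    Filter.Tendsto (β r) Filter.atTop (nhds 0)

/-- A real square matrix is (Schur) stable: all its complex eigenvalues lie in the open unit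
disc. -/
def IsSchurStable {d : ℕ} (A : Matrix (Fin d) (Fin d) ℝ) : Prop :=
  ∀ μ ∈ spectrum ℂ (A.map (fun c : ℝ => (c : ℂ))), ‖μ‖ < 1

/-- The vector obtained by stacking `v 0, …, v (n - 1)`. -/
def stackVec {n : ℕ} {ι : Type} (v : Fin n → ι → ℝ) : Fin n × ι → ℝ := fun k => v k.1 k.2

/-- The decision variables of the MPC problem of horizon `n`: the disturbance feedback gain `M`,
the nominal states `xbar 0, …, xbar n` and the nominal inputs `ubar 0, …, ubar (n - 1)`. -/
structure Decision (d m n : ℕ) where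
  M : Matrix (Fin n × Fin m) (Fin n × Fin d) ℝ
  xbar : Fin (n + 1) → Fin d → ℝ
  ubar : Fin n → Fin m → ℝ

/-- The affine disturbance feedback policy: the input planned for the `k`-th step, when the
disturbances since the start of the plan have been `ω 0, ω 1, …`. It is
`∑_{l < k} M_{k,l} ω_l + ubar_k`. -/
def Decision.input {d m n : ℕ} (z : Decision d m n) (ω : ℕ → Fin d → ℝ) (k : Fin n) :
    Fin m → ℝ :=
  fun i => (∑ l ∈ Finset.Iio k, ∑ c, z.M (k, i) (l, c) * ω l c) + z.ubar k i

/-- The data of the control problem. The state, input, disturbance and terminal polytopes are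
`{x | Hx x ≤ hx}`, `{u | Hu u ≤ hu}`, `{w | Hw w ≤ hw}`, `{x | HN x ≤ hN}`; the vertices of the
sets of model errors are `vA` and `vB`; `wmax n` is the number bounding the norm of a stacked
sequence of `n` disturbances. -/
structure MPCData (d m r o rN a na nb : ℕ) where
  Abar : Matrix (Fin d) (Fin d) ℝ
  Bbar : Matrix (Fin d) (Fin m) ℝ
  vA : Fin na → Matrix (Fin d) (Fin d) ℝ
  vB : Fin nb → Matrix (Fin d) (Fin m) ℝ
  Hx : Matrix (Fin r) (Fin d) ℝ
  hx : Fin r → ℝ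
  Hu : Matrix (Fin o) (Fin m) ℝ
  hu : Fin o → ℝ
  Hw : Matrix (Fin a) (Fin d) ℝ
  hw : Fin a → ℝ
  HN : Matrix (Fin rN) (Fin d) ℝ
  hN : Fin rN → ℝ
  K : Matrix (Fin m) (Fin d) ℝ
  P : Matrix (Fin d) (Fin d) ℝ
  R : Matrix (Fin m) (Fin m) ℝ
  PN : Matrix (Fin d) (Fin d) ℝ
  N : ℕ
  wmax : ℕ → ℝ

namespace MPCData

variable {d m r o rN a na nb : ℕ} (D : MPCData d m r o rN a na nb)

/-! ### The sets -/

/-- State constraints. -/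
def X : Set (Fin d → ℝ) := {x | D.Hx *ᵥ x ≤ D.hx}

/-- Input constraints. -/
def U : Set (Fin m → ℝ) := {u | D.Hu *ᵥ u ≤ D.hu}

/-- Disturbance set. -/
def W : Set (Fin d → ℝ) := {w | D.Hw *ᵥ w ≤ D.hw}

/-- Terminal set. -/
def XN : Set (Fin d → ℝ) := {x | D.HN *ᵥ x ≤ D.hN}

/-- Set of possible errors of `Abar`. -/
def PA : Set (Matrix (Fin d) (Fin d) ℝ) := convexHull ℝ (Set.range D.vA)

/-- Set of possible errors of `Bbar`. -/
def PB : Set (Matrix (Fin d) (Fin m) ℝ) := convexHull ℝ (Set.range D.vB)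

/-- `S` is a robust positive invariant set, within the state and input constraints, of
`x⁺ = (A + B K) x + w` for all `A ∈ Abar + PA`, `B ∈ Bbar + PB`, `w ∈ W`. -/
def IsRobustInvariant (S : Set (Fin d → ℝ)) : Prop :=
  (∀ x ∈ S, x ∈ D.X ∧ D.K *ᵥ x ∈ D.U) ∧
  ∀ x ∈ S, ∀ ΔA ∈ D.PA, ∀ ΔB ∈ D.PB, ∀ w ∈ D.W,
    ((D.Abar + ΔA) + (D.Bbar + ΔB) * D.K) *ᵥ x + w ∈ S

/-- The terminal set is the maximal robust positive invariant set. -/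
def TerminalSetMaximal : Prop := IsGreatest {S | D.IsRobustInvariant S} D.XN

/-- `wmax n` bounds the norm of every stacked sequence of `n ≤ N` disturbances. -/
def DisturbanceBound (p : ℝ≥0∞) : Prop :=
  ∀ n ≤ D.N, ∀ ω : Fin n → Fin d → ℝ, (∀ k, ω k ∈ D.W) → vnorm p (stackVec ω) ≤ D.wmax n

/-- The gain `K` robustly stabilizes the system. -/
def RobustlyStabilizing : Prop :=
  ∀ ΔA ∈ D.PA, ∀ ΔB ∈ D.PB, IsSchurStable ((D.Abar + ΔA) + (D.Bbar + ΔB) * D.K)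

/-- The condition on the terminal weight. -/
def TerminalCostDecrease : Prop :=
  ∀ x ∈ D.XN,
    x ⬝ᵥ ((-D.PN + (D.P + D.Kᵀ * D.R * D.K)
      + (D.Abar + D.Bbar * D.K)ᵀ * D.PN * (D.Abar + D.Bbar * D.K)) *ᵥ x) ≤ 0

/-! ### Stacked matrices for horizon `n` -/

/-- `diag(I_{n-1} ⊗ Hx, HN)`. -/
def F (n : ℕ) : Matrix ((Fin (n - 1) × Fin r) ⊕ Fin rN) (Fin n × Fin d) ℝ
  | Sum.inl (k, i), (l, c) => if (l : ℕ) = k then D.Hx i c else 0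
  | Sum.inr i, (l, c) => if (l : ℕ) + 1 = n then D.HN i c else 0

/-- `(hx, …, hx, hN)`. -/
def f (n : ℕ) : (Fin (n - 1) × Fin r) ⊕ Fin rN → ℝ
  | Sum.inl (_, i) => D.hx i
  | Sum.inr i => D.hN i

/-- `I_n ⊗ Abar`. -/
def bigA (n : ℕ) : Matrix (Fin n × Fin d) (Fin n × Fin d) ℝ :=
  (1 : Matrix (Fin n) (Fin n) ℝ) ⊗ₖ D.Abar

/-- `I_n ⊗ Bbar`. -/
def bigB (n : ℕ) : Matrix (Fin n × Fin d) (Fin n × Fin m) ℝ :=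
  (1 : Matrix (Fin n) (Fin n) ℝ) ⊗ₖ D.Bbar

/-- The block lower triangular matrix with blocks `Abar ^ (k - l)`. -/
def bigA1 (n : ℕ) : Matrix (Fin n × Fin d) (Fin n × Fin d) ℝ :=
  fun k l => if l.1 ≤ k.1 then (D.Abar ^ ((k.1 : ℕ) - (l.1 : ℕ))) k.2 l.2 else 0

/-- `[A_v^(1) … A_v^(n-1)]`, where `A_v^(j)` has identity blocks on its `j`-th block
subdiagonal and zeros elsewhere. The column block `j` here is `A_v^(j+1)`. -/
def bigAv (d n : ℕ) : Matrix (Fin n × Fin d) (Fin (n - 1) × (Fin n × Fin d)) ℝ :=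
  fun k jl => if (k.1 : ℕ) = (jl.2.1 : ℕ) + ((jl.1 : ℕ) + 1) ∧ k.2 = jl.2.2 then 1 else 0

/-- The matrices `I_n ⊗ Δ_1, …, I_n ⊗ Δ_{n-1}` on top of each other (`Δ_{j+1}` is `Δ j`). -/
def stackMat (n : ℕ) (Δ : Fin (n - 1) → Matrix (Fin d) (Fin d) ℝ) :
    Matrix (Fin (n - 1) × (Fin n × Fin d)) (Fin n × Fin d) ℝ :=
  fun jk l => ((1 : Matrix (Fin n) (Fin n) ℝ) ⊗ₖ Δ jk.1) jk.2 l

/-- The convex hull of all products of `j` matrices out of the vertices `Abar + vA i`. -/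
def PApow (j : ℕ) : Set (Matrix (Fin d) (Fin d) ℝ) :=
  convexHull ℝ (Set.range fun s : Fin j → Fin na =>
    (List.ofFn fun i => D.Abar + D.vA (s i)).prod)

/-- All families `Δ_1, …, Δ_{n-1}` with `Δ_j` in the hull of the products of `j` vertices. -/
def powFamilies (n : ℕ) : Set (Fin (n - 1) → Matrix (Fin d) (Fin d) ℝ) :=
  {Δ | ∀ j : Fin (n - 1), Δ j ∈ D.PApow ((j : ℕ) + 1)}

/-! ### Offline bounds -/

section bounds

variable (p : ℝ≥0∞) [Fact (1 ≤ p)] (n : ℕ) (i : (Fin (n - 1) × Fin r) ⊕ Fin rN)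

def t0 : ℝ :=
  maxOver (D.powFamilies n) fun Δ =>
    dualNorm p (D.F n i ᵥ* (bigAv d n * stackMat n fun j => Δ j - D.Abar ^ ((j : ℕ) + 1)))

def tw : ℝ :=
  maxOver (D.powFamilies n) fun Δ => dualNorm p (D.F n i ᵥ* (bigAv d n * stackMat n Δ))

def t1 : ℝ :=
  D.t0 p n i * maxOver D.PA fun Δ => inducedNorm p ((1 : Matrix (Fin n) (Fin n) ℝ) ⊗ₖ Δ)

def t2 : ℝ :=
  D.t0 p n i * maxOver D.PB fun Δ => inducedNorm p ((1 : Matrix (Fin n) (Fin n) ℝ) ⊗ₖ Δ)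

def t3 : ℝ := D.t0 p n i * inducedNorm p (D.bigB n)

def tδA : ℝ :=
  maxOver D.PA fun Δ => dualNorm p (D.F n i ᵥ* (D.bigA1 n * (1 : Matrix (Fin n) (Fin n) ℝ) ⊗ₖ Δ))

def tδB : ℝ :=
  maxOver D.PB fun Δ => dualNorm p (D.F n i ᵥ* (D.bigA1 n * (1 : Matrix (Fin n) (Fin n) ℝ) ⊗ₖ Δ))

def tδ1 : ℝ := D.tδA p n i + D.t1 p n i

def tδ2 : ℝ := D.tδB p n i + D.t2 p n i

def tδ3 : ℝ := D.tδB p n i + D.t2 p n i + D.t3 p n i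

end bounds

/-! ### The MPC problem of horizon `n` -/

section problem

variable (p : ℝ≥0∞) [Fact (1 ≤ p)] {n : ℕ}

/-- The tightened right-hand side, a function of the decision variables. -/
def ftight (z : Decision d m n) (i : (Fin (n - 1) × Fin r) ⊕ Fin rN) : ℝ :=
  D.f n i - D.tδ1 p n i * vnorm p (stackVec fun k : Fin n => z.xbar k.castSucc)
    - D.tδ3 p n i * inducedNorm p z.M * D.wmax n
    - D.tδ2 p n i * vnorm p (stackVec z.ubar)
    - D.tw p n i * D.wmax n

/-- Robust state and terminal constraints for horizons `n ≥ 2`. -/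
def StateConMulti (z : Decision d m n) : Prop :=
  ∀ ω : Fin n → Fin d → ℝ, (∀ k, ω k ∈ D.W) → ∀ i,
    D.F n i ⬝ᵥ
      (D.bigA n *ᵥ stackVec (fun k : Fin n => z.xbar k.castSucc)
        + D.bigB n *ᵥ (z.M *ᵥ stackVec ω + stackVec z.ubar)
        + ((D.bigA1 n - 1) * D.bigB n * z.M) *ᵥ stackVec ω + stackVec ω)
      ≤ D.ftight p z i

/-- Robust terminal constraint for horizon `1`, imposed without over-approximation. -/
def StateConOne (z : Decision d m n) : Prop :=
  ∀ w ∈ D.W, ∀ ΔA ∈ D.PA, ∀ ΔB ∈ D.PB, ∀ k : Fin n,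
    D.HN *ᵥ ((D.Abar + ΔA) *ᵥ z.xbar k.castSucc + (D.Bbar + ΔB) *ᵥ z.ubar k + w) ≤ D.hN

/-- Robust input constraints. -/
def InputCon (z : Decision d m n) : Prop :=
  ∀ ω : Fin n → Fin d → ℝ, (∀ k, ω k ∈ D.W) → ∀ k : Fin n,
    (fun i => (z.M *ᵥ stackVec ω + stackVec z.ubar) (k, i)) ∈ D.U

/-- `z` satisfies the constraints of the MPC problem of horizon `n` with current state `x`. -/
def Admissible (x : Fin d → ℝ) (z : Decision d m n) : Prop :=
  (∀ (k l : Fin n) (i : Fin m) (c : Fin d), k ≤ l → z.M (k, i) (l, c) = 0) ∧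
  z.xbar 0 = x ∧
  (∀ k : Fin n, z.xbar k.succ = D.Abar *ᵥ z.xbar k.castSucc + D.Bbar *ᵥ z.ubar k) ∧
  (if n = 1 then D.StateConOne z else D.StateConMulti p z) ∧
  D.InputCon z

/-- The nominal cost. -/
def cost (z : Decision d m n) : ℝ :=
  (∑ k : Fin n, z.xbar k.castSucc ⬝ᵥ (D.P *ᵥ z.xbar k.castSucc))
    + z.xbar (Fin.last n) ⬝ᵥ (D.PN *ᵥ z.xbar (Fin.last n))
    + ∑ k : Fin n, z.ubar k ⬝ᵥ (D.R *ᵥ z.ubar k)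

/-- `z` is an optimal solution of the MPC problem with current state `x`. -/
def IsOptimal (x : Fin d → ℝ) (z : Decision d m n) : Prop :=
  D.Admissible p x z ∧ ∀ z' : Decision d m n, D.Admissible p x z' → D.cost z ≤ D.cost z'

/-- The MPC problem of horizon `n` is feasible at the state `x`. -/
def Feasible (n : ℕ) (x : Fin d → ℝ) : Prop := ∃ z : Decision d m n, D.Admissible p x z

/-- The optimal value of the MPC problem of horizon `n` (the value `0` at infeasible states is
never used). -/
def value (n : ℕ) (x : Fin d → ℝ) : ℝ :=
  sInf {c | ∃ z : Decision d m n, D.Admissible p x z ∧ c = D.cost z}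

end problem

/-! ### The closed loop -/

/-- The shrinking horizon at time `t`. -/
def horizon (t : ℕ) : ℕ := if t + 2 ≤ D.N then D.N - t else 1

theorem horizon_pos (t : ℕ) : 0 < D.horizon t := by
  unfold horizon
  split_ifs <;> omega

/-- The lumped disturbance `ΔA x + ΔB u + w` at time `t`. -/
def lumped (ΔA : Matrix (Fin d) (Fin d) ℝ) (ΔB : Matrix (Fin d) (Fin m) ℝ)
    (x : ℕ → Fin d → ℝ) (u : ℕ → Fin m → ℝ) (w : ℕ → Fin d → ℝ) (t : ℕ) : Fin d → ℝ :=
  ΔA *ᵥ x t + ΔB *ᵥ u t + w t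

/-- `x`, `u`, `w` are the states, inputs and disturbances on the times `t ≥ s` of the MPC closed
loop started at time `s`, for the true model errors `ΔA`, `ΔB`; `z t` is the optimal solution
found by the controller at time `t`, if there is one to be found. -/
structure IsClosedLoop (p : ℝ≥0∞) [Fact (1 ≤ p)]
    (ΔA : Matrix (Fin d) (Fin d) ℝ) (ΔB : Matrix (Fin d) (Fin m) ℝ) (s : ℕ)
    (x : ℕ → Fin d → ℝ) (u : ℕ → Fin m → ℝ) (w : ℕ → Fin d → ℝ)
    (z : (t : ℕ) → Decision d m (D.horizon t)) : Prop where
  disturbance : ∀ t, s ≤ t → w t ∈ D.W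
  dynamics : ∀ t, s ≤ t → x (t + 1) = (D.Abar + ΔA) *ᵥ x t + (D.Bbar + ΔB) *ᵥ u t + w t
  optimal : ∀ t, s ≤ t → D.Feasible p (D.horizon t) (x t) → D.IsOptimal p (x t) (z t)
  /-- If the problem is feasible, its first optimal nominal input is applied. -/
  mpc : ∀ t, s ≤ t → D.Feasible p (D.horizon t) (x t) →
    u t = (z t).ubar ⟨0, D.horizon_pos t⟩
  /-- Otherwise the plan made at the latest time `tf` of feasibility is continued. -/
  backup : ∀ t, s ≤ t → ¬ D.Feasible p (D.horizon t) (x t) →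
    ∀ tf, s ≤ tf → tf < t → D.Feasible p (D.horizon tf) (x tf) →
      (∀ j, tf < j → j < t → ¬ D.Feasible p (D.horizon j) (x j)) →
      ∀ h : t - tf < D.horizon tf,
        u t = (z tf).input (fun l => w (tf + l)) ⟨t - tf, h⟩

/-- `V` is an ISS Lyapunov function in the terminal set for the closed loop at the times with
horizon `1`, i.e. for all closed loops started at a time `s ≥ N - 1` in the terminal set. (The part
after a time `s` of a closed loop started earlier is a closed loop started at `s`.) -/
def IsISSLyapunov (p : ℝ≥0∞) [Fact (1 ≤ p)]
    (ΔA : Matrix (Fin d) (Fin d) ℝ) (ΔB : Matrix (Fin d) (Fin m) ℝ)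
    (V : (Fin d → ℝ) → ℝ) : Prop :=
  (∀ x, 0 ≤ V x) ∧ ContinuousOn V D.XN ∧
  ∃ α₁ α₂ α₃ σ : ℝ → ℝ,
    IsClassKInf α₁ ∧ IsClassKInf α₂ ∧ IsClassKInf α₃ ∧ IsClassK σ ∧
    (∀ x ∈ D.XN, α₁ (vnorm p x) ≤ V x ∧ V x ≤ α₂ (vnorm p x)) ∧
    ∀ s x u w z, D.N ≤ s + 1 → D.IsClosedLoop p ΔA ΔB s x u w z → x s ∈ D.XN →
      ∀ k : ℕ, V (x (s + k + 1)) - V (x (s + k)) ≤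
        -α₃ (vnorm p (x (s + k)))
          + σ (⨆ i : Fin (k + 1), vnorm p (lumped ΔA ΔB x u w (s + i)))

/-- The origin is input-to-state stable in the terminal set for the closed loop at the times with
horizon `1`. -/
def IsISS (p : ℝ≥0∞) [Fact (1 ≤ p)]
    (ΔA : Matrix (Fin d) (Fin d) ℝ) (ΔB : Matrix (Fin d) (Fin m) ℝ) : Prop :=
  ∃ (β : ℝ → ℝ → ℝ) (γ : ℝ → ℝ), IsClassKL β ∧ IsClassK γ ∧
    ∀ s x u w z, D.N ≤ s + 1 → D.IsClosedLoop p ΔA ΔB s x u w z → x s ∈ D.XN →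
      ∀ k : ℕ, vnorm p (x (s + k + 1)) ≤
        β (vnorm p (x s)) ((k : ℝ) + 1)
          + γ (⨆ i : Fin (k + 1), vnorm p (lumped ΔA ΔB x u w (s + i)))

end MPCData

end

/-! ### Norms -/

section Norms

variable {p : ℝ≥0∞} {ι κ : Type} [Fintype ι] [Fintype κ]

/-! Reaching the terminal set. Let `τ` be the latest time up to `N - 1` at which the problem was
feasible. The plan made at `τ` has horizon `N - τ` and is never replaced before time `N`, so it is
carried out in full. Such a plan ends in `XN` (`mem_XN_of_plan`). For horizon one this is the
constraint itself. For longer horizons the deviation from the nominal trajectory solves a linear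
recursion driven by the model errors and disturbances (`stacked_states`), and Hölder's inequality
bounds its effect on a constraint row by exactly the tightening (`row_bound`). Inside `XN` the input
`K x` makes the problem of horizon one feasible, so `XN` is never left.

Stability. Let `V` be the value of horizon one and `y = Abar x + Bbar u` the nominal successor under
the optimal input. Then `V x = xᵀ P x + uᵀ R u + yᵀ PN y`, while testing with `K x` gives `V x ≤ xᵀ
PN x` on `XN`. The true successor is `y + e` with `e` the lumped disturbance, so `V (y + e) ≤ (y +
e)ᵀ PN (y + e)`. Expanding, with `y` bounded by compactness, yields a decrease of at least `xᵀ P x`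
up to a term linear plus quadratic in the norm of `e` (`exists_lyapunov_constants`). As `V` lies
between multiples of the squared norm, it contracts geometrically up to a gain, and square roots
give the ISS estimate.

Continuity of `V`. Lower semicontinuity comes from compactness of the feasible inputs. Upper
semicontinuity comes from convexity: a convex function bounded above on a polyhedron is upper
semicontinuous even at the boundary. -/

theorem vnorm_zero [Fact (1 ≤ p)] : vnorm p (0 : ι → ℝ) = 0 := by
  simp [vnorm]

theorem vnorm_nonneg [Fact (1 ≤ p)] (v : ι → ℝ) : 0 ≤ vnorm p v := norm_nonneg _

theorem vnorm_add_le [Fact (1 ≤ p)] (v w : ι → ℝ) : vnorm p (v + w) ≤ vnorm p v + vnorm p w := by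
  simpa [vnorm] using norm_add_le (WithLp.toLp p v) (WithLp.toLp p w)

theorem vnorm_smul [Fact (1 ≤ p)] (c : ℝ) (v : ι → ℝ) : vnorm p (c • v) = |c| * vnorm p v := by
  simp [vnorm, WithLp.toLp_smul, norm_smul]

theorem vnorm_eq_zero [Fact (1 ≤ p)] {v : ι → ℝ} : vnorm p v = 0 ↔ v = 0 := by
  simp [vnorm]

theorem abs_apply_le_vnorm [Fact (1 ≤ p)] (v : ι → ℝ) (i : ι) : |v i| ≤ vnorm p v := by
  simpa [vnorm] using PiLp.norm_apply_le (WithLp.toLp p v) i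

theorem continuous_vnorm [Fact (1 ≤ p)] : Continuous (vnorm p : (ι → ℝ) → ℝ) :=
  continuous_norm.comp (PiLp.continuous_toLp p _)

/-- Coordinates in the unit ball of any `p`-norm are at most 1 in absolute value. This bound, crude
but uniform in `p`, makes the `sSup` in `dualNorm` a genuine supremum. -/
theorem dotProduct_le_sum_abs [Fact (1 ≤ p)] {y : ι → ℝ} (hy : vnorm p y ≤ 1) (v : ι → ℝ) :
    y ⬝ᵥ v ≤ ∑ i, |v i| := by
  refine Finset.sum_le_sum fun i _ => (le_abs_self _).trans ?_
  rw [abs_mul]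
  exact mul_le_of_le_one_left (abs_nonneg _) ((abs_apply_le_vnorm y i).trans hy)

theorem bddAbove_dualNorm [Fact (1 ≤ p)] (v : ι → ℝ) :
    BddAbove {c | ∃ y : ι → ℝ, vnorm p y ≤ 1 ∧ c = y ⬝ᵥ v} := by
  refine ⟨∑ i, |v i|, ?_⟩
  rintro _ ⟨y, hy, rfl⟩
  exact dotProduct_le_sum_abs hy v

theorem dualNorm_nonneg [Fact (1 ≤ p)] (v : ι → ℝ) : 0 ≤ dualNorm p v :=
  le_csSup (bddAbove_dualNorm v) ⟨0, by simp [vnorm_zero], by simp⟩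

theorem dualNorm_le_sum_abs [Fact (1 ≤ p)] (v : ι → ℝ) : dualNorm p v ≤ ∑ i, |v i| := by
  refine csSup_le ⟨0, 0, by simp [vnorm_zero], by simp⟩ ?_
  rintro _ ⟨y, hy, rfl⟩
  exact dotProduct_le_sum_abs hy v

/-- Hölder's inequality. -/
theorem dotProduct_le_dualNorm_mul [Fact (1 ≤ p)] (v y : ι → ℝ) :
    v ⬝ᵥ y ≤ dualNorm p v * vnorm p y := by
  rcases eq_or_ne y 0 with rfl | hy
  · simp [vnorm_zero]
  have hpos : 0 < vnorm p y :=
    lt_of_le_of_ne (vnorm_nonneg y) fun h => hy (vnorm_eq_zero.1 h.symm)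
  have h : ((vnorm p y)⁻¹ • y) ⬝ᵥ v ≤ dualNorm p v := by
    refine le_csSup (bddAbove_dualNorm v) ⟨_, ?_, rfl⟩
    rw [vnorm_smul, abs_of_pos (inv_pos.2 hpos), inv_mul_cancel₀ hpos.ne']
  rw [smul_dotProduct, smul_eq_mul, inv_mul_le_iff₀ hpos, dotProduct_comm, mul_comm] at h
  exact h

theorem vnorm_mulVec_le [Fact (1 ≤ p)] [DecidableEq κ] (A : Matrix ι κ ℝ) (x : κ → ℝ) :
    vnorm p (A *ᵥ x) ≤ inducedNorm p A * vnorm p x := by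
  simpa [inducedNorm, vnorm, Matrix.toLpLin_apply] using
    (Matrix.toLpLin p p A).toContinuousLinearMap.le_opNorm (WithLp.toLp p x)

theorem inducedNorm_nonneg [Fact (1 ≤ p)] [DecidableEq κ] (A : Matrix ι κ ℝ) :
    0 ≤ inducedNorm p A := norm_nonneg _

theorem continuous_inducedNorm [Fact (1 ≤ p)] [DecidableEq κ] :
    Continuous (inducedNorm p : Matrix ι κ ℝ → ℝ) := by
  have h : Continuous fun A : Matrix ι κ ℝ => (Matrix.toLpLin p p A).toContinuousLinearMap := by
    let L : Matrix ι κ ℝ →ₗ[ℝ] (WithLp p (κ → ℝ) →L[ℝ] WithLp p (ι → ℝ)) :=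
      LinearMap.toContinuousLinearMap.toLinearMap ∘ₗ (Matrix.toLpLin p p).toLinearMap
    exact L.continuous_of_finiteDimensional
  exact h.norm

/-- Hölder's inequality for a row functional composed with a matrix. -/
theorem dotProduct_mulVec_le [Fact (1 ≤ p)] (F : ι → ℝ) (A : Matrix ι κ ℝ) (y : κ → ℝ) :
    F ⬝ᵥ (A *ᵥ y) ≤ dualNorm p (F ᵥ* A) * vnorm p y := by
  rw [Matrix.dotProduct_mulVec]
  exact dotProduct_le_dualNorm_mul _ _

end Norms

/-! ### Maxima over compact sets -/

/-- A continuous majorant suffices to bound the image, so `dualNorm` can be handled through the sum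
of absolute values without proving it continuous. -/
theorem le_maxOver_of_le {α : Type} [TopologicalSpace α] {S : Set α} (hS : IsCompact S)
    {f g : α → ℝ} (hg : Continuous g) (hfg : ∀ x, f x ≤ g x) {x : α} (hx : x ∈ S) :
    f x ≤ maxOver S f := by
  obtain ⟨B, hB⟩ := hS.bddAbove_image hg.continuousOn
  refine le_csSup ⟨B, ?_⟩ ⟨x, hx, rfl⟩
  rintro _ ⟨y, hy, rfl⟩
  exact (hfg y).trans (hB ⟨y, hy, rfl⟩)

theorem dualNorm_le_maxOver {p : ℝ≥0∞} [Fact (1 ≤ p)] {ι α : Type} [Fintype ι]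
    [TopologicalSpace α] {S : Set α} (hS : IsCompact S) {v : α → ι → ℝ} (hv : Continuous v)
    {x : α} (hx : x ∈ S) : dualNorm p (v x) ≤ maxOver S fun x => dualNorm p (v x) :=
  le_maxOver_of_le (f := fun x => dualNorm p (v x)) hS
    (continuous_finsetSum _ fun i _ => ((continuous_apply i).comp hv).abs)
    (fun x => dualNorm_le_sum_abs (v x)) hx

/-! ### Block matrices -/

section Blocks

variable {d m n : ℕ}

/-- The strictly block lower triangular Toeplitz matrix with blocks `G (k - l)`. -/
theorem bigAv_mul_stackMat (G : ℕ → Matrix (Fin d) (Fin d) ℝ) (k l : Fin n × Fin d) :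
    (MPCData.bigAv d n * MPCData.stackMat n fun j => G ((j : ℕ) + 1)) k l =
      if l.1 < k.1 then G ((k.1 : ℕ) - l.1) k.2 l.2 else 0 := by
  obtain ⟨k, a⟩ := k
  obtain ⟨l, b⟩ := l
  have h : (MPCData.bigAv d n * MPCData.stackMat n fun j => G ((j : ℕ) + 1)) (k, a) (l, b) =
      ∑ j : Fin (n - 1), if (k : ℕ) = l + (j + 1) then G ((j : ℕ) + 1) a b else 0 := by
    rw [Matrix.mul_apply, Fintype.sum_prod_type]
    refine Finset.sum_congr rfl fun j _ => ?_
    rw [Fintype.sum_prod_type, Finset.sum_eq_single l, Finset.sum_eq_single a]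
    · simp [MPCData.bigAv, MPCData.stackMat]
    · intro c _ hc
      simp [MPCData.bigAv, hc.symm]
    · simp
    · intro q _ hq
      simp [MPCData.stackMat, hq]
    · simp
  rw [h]
  split_ifs with hlk
  · have hlk' : (l : ℕ) < k := hlk
    rw [Finset.sum_eq_single ⟨(k : ℕ) - l - 1, by omega⟩]
    · have : (k : ℕ) - l - 1 + 1 = k - l := by omega
      simp only [this]
      rw [if_pos (by omega)]
    · intro j _ hj
      refine if_neg fun hk => hj (Fin.ext ?_)
      simp only
      omega
    · simp
  · have hlk' : ¬ (l : ℕ) < k := hlk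
    exact Finset.sum_eq_zero fun j _ => if_neg (by omega)

theorem one_kronecker_mulVec {ι κ : Type} [Fintype κ] (Δ : Matrix ι κ ℝ) (v : Fin n → κ → ℝ) :
    ((1 : Matrix (Fin n) (Fin n) ℝ) ⊗ₖ Δ) *ᵥ stackVec v = stackVec fun k => Δ *ᵥ v k := by
  ext ⟨k, a⟩
  simp only [Matrix.mulVec, dotProduct, Fintype.sum_prod_type, stackVec,
    Matrix.kroneckerMap_apply]
  rw [Finset.sum_eq_single k]
  · simp
  · intro q _ hq
    simp [hq.symm]
  · simp

theorem stackVec_add {ι : Type} (v w : Fin n → ι → ℝ) :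
    stackVec v + stackVec w = stackVec (v + w) := rfl

/-- The stacked solution of `e (k + 1) = A e k + g k`, `e 0 = 0`. -/
theorem lowerTriangular_mulVec_eq (A : Matrix (Fin d) (Fin d) ℝ) (T : Matrix (Fin n × Fin d)
    (Fin n × Fin d) ℝ)
    (hT : ∀ k l, T k l = if l.1 ≤ k.1 then (A ^ ((k.1 : ℕ) - l.1)) k.2 l.2 else 0)
    (e g : ℕ → Fin d → ℝ) (he0 : e 0 = 0) (he : ∀ k < n, e (k + 1) = A *ᵥ e k + g k) :
    T *ᵥ stackVec (fun k : Fin n => g k) = stackVec fun k : Fin n => e (k + 1) := by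
  -- Discrete variation of constants. The truncated subtraction is harmless because `l < k` in the
  -- sum.
  have key : ∀ k ≤ n, e k = ∑ l ∈ Finset.range k, A ^ (k - 1 - l) *ᵥ g l := by
    intro k
    induction k with
    | zero => simp [he0]
    | succ k ih =>
      intro hk
      rw [he k hk, ih (by omega), Finset.sum_range_succ, Matrix.mulVec_sum]
      congr 1
      · refine Finset.sum_congr rfl fun l hl => ?_
        have hl' := Finset.mem_range.1 hl
        rw [Matrix.mulVec_mulVec, ← pow_succ']
        congr 2
        omega
      · simp
  ext ⟨k, a⟩
  have hk : ∀ l : Fin n, (∑ b, T (k, a) (l, b) * g l b) =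
      if (l : ℕ) ∈ Finset.range (k + 1) then (A ^ ((k : ℕ) - l) *ᵥ g l) a else 0 := by
    intro l
    simp only [hT, Finset.mem_range, Nat.lt_succ_iff, Fin.le_def]
    split_ifs <;> simp [Matrix.mulVec, dotProduct]
  simp only [Matrix.mulVec, dotProduct, Fintype.sum_prod_type, stackVec] at hk ⊢
  rw [Finset.sum_congr rfl fun l _ => hk l, key _ k.2, Finset.sum_apply,
    Fin.sum_univ_eq_sum_range (fun l => if l ∈ Finset.range ((k : ℕ) + 1) then
      ∑ b, (A ^ ((k : ℕ) - l)) a b * g l b else 0), Finset.sum_ite_mem,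
    Finset.inter_eq_right.2 (Finset.range_subset_range.2 k.2)]
  simp [Matrix.mulVec, dotProduct]

end Blocks

namespace MPCData

variable {d m r o rN a na nb : ℕ} (D : MPCData d m r o rN a na nb)

/-! ### Hulls of the model errors -/

theorem isCompact_PA : IsCompact D.PA := (Set.finite_range _).isCompact_convexHull ℝ

theorem isCompact_PB : IsCompact D.PB := (Set.finite_range _).isCompact_convexHull ℝ

theorem isCompact_PApow (j : ℕ) : IsCompact (D.PApow j) :=
  (Set.finite_range _).isCompact_convexHull ℝ

theorem isCompact_powFamilies (n : ℕ) : IsCompact (D.powFamilies n) := by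
  have := isCompact_univ_pi fun j : Fin (n - 1) => D.isCompact_PApow ((j : ℕ) + 1)
  convert this using 1
  ext Δ
  simp [powFamilies]

/-- The product is affine in each factor separately, so the hull can be reduced to its vertices one
factor at a time: first in `Y` at a fixed vertex of `PA`, then in `ΔA` with `Y` fixed. -/
theorem mul_mem_PApow {j : ℕ} {ΔA Y : Matrix (Fin d) (Fin d) ℝ} (hΔA : ΔA ∈ D.PA)
    (hY : Y ∈ D.PApow j) : (D.Abar + ΔA) * Y ∈ D.PApow (j + 1) := by
  have hconv : Convex ℝ (D.PApow (j + 1)) := convex_convexHull ℝ _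
  have hvert : ∀ i, ∀ Y ∈ D.PApow j, (D.Abar + D.vA i) * Y ∈ D.PApow (j + 1) := by
    intro i Y hY
    refine convexHull_min (t := (LinearMap.mulLeft ℝ (D.Abar + D.vA i)) ⁻¹' D.PApow (j + 1))
      ?_ (hconv.linear_preimage _) hY
    rintro _ ⟨s, rfl⟩
    refine subset_convexHull ℝ _ ⟨Fin.cons i s, ?_⟩
    simp [List.ofFn_succ]
  have hpre : Convex ℝ ((fun Z => (D.Abar + Z) * Y) ⁻¹' D.PApow (j + 1)) := by
    intro Z hZ Z' hZ' α β hα hβ hαβ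
    have := hconv hZ hZ' hα hβ hαβ
    rw [Set.mem_preimage]
    convert this using 1
    have : D.Abar = α • D.Abar + β • D.Abar := by rw [← add_smul, hαβ, one_smul]
    conv_lhs => rw [this]
    simp only [add_mul, smul_add, smul_mul_assoc]
    abel
  refine convexHull_min ?_ hpre hΔA
  rintro _ ⟨i, rfl⟩
  exact hvert i Y hY

/-- Hence the powers of the true matrix form one of the families over which `t0` and `tw` are
maximized. -/
theorem pow_mem_PApow {ΔA : Matrix (Fin d) (Fin d) ℝ} (hΔA : ΔA ∈ D.PA) (j : ℕ) :
    (D.Abar + ΔA) ^ j ∈ D.PApow j := by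
  induction j with
  | zero => exact subset_convexHull ℝ _ ⟨Fin.elim0, by simp⟩
  | succ j ih =>
    rw [pow_succ']
    exact D.mul_mem_PApow hΔA ih

/-! ### The offline bounds -/

section bounds

variable (p : ℝ≥0∞) [Fact (1 ≤ p)] (n : ℕ) (i : (Fin (n - 1) × Fin r) ⊕ Fin rN)
  {ΔA : Matrix (Fin d) (Fin d) ℝ} {ΔB : Matrix (Fin d) (Fin m) ℝ}

theorem continuous_stackMat :
    Continuous (stackMat n : (Fin (n - 1) → Matrix (Fin d) (Fin d) ℝ) → _) := by
  refine continuous_matrix fun jk l => ?_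
  simp only [stackMat, Matrix.kroneckerMap_apply]
  exact continuous_const.mul ((continuous_apply jk.1).matrix_elem _ _)

theorem continuous_one_kronecker {κ : Type} :
    Continuous fun Δ : Matrix (Fin d) κ ℝ => (1 : Matrix (Fin n) (Fin n) ℝ) ⊗ₖ Δ := by
  refine continuous_matrix fun k l => ?_
  simp only [Matrix.kroneckerMap_apply]
  exact continuous_const.mul (continuous_id.matrix_elem _ _)

theorem continuous_vecMul_mul {α ι κ μ : Type} [TopologicalSpace α] [Fintype ι] [Fintype κ]
    (F : ι → ℝ) (A : Matrix ι κ ℝ) {B : α → Matrix κ μ ℝ} (hB : Continuous B) :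
    Continuous fun x => F ᵥ* (A * B x) :=
  continuous_const.matrix_vecMul (continuous_const.matrix_mul hB)

theorem dualNorm_le_t0 (hΔA : ΔA ∈ D.PA) :
    dualNorm p (D.F n i ᵥ* (bigAv d n * stackMat n fun j =>
      (D.Abar + ΔA) ^ ((j : ℕ) + 1) - D.Abar ^ ((j : ℕ) + 1))) ≤ D.t0 p n i :=
  dualNorm_le_maxOver (D.isCompact_powFamilies n)
    (v := fun Δ => D.F n i ᵥ* (bigAv d n * stackMat n fun j => Δ j - D.Abar ^ ((j : ℕ) + 1)))
    (x := fun j => (D.Abar + ΔA) ^ ((j : ℕ) + 1))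
    (continuous_vecMul_mul _ _ ((continuous_stackMat n).comp
      (continuous_pi fun j => (continuous_apply j).sub continuous_const)))
    fun _ => D.pow_mem_PApow hΔA _

theorem dualNorm_le_tw (hΔA : ΔA ∈ D.PA) :
    dualNorm p (D.F n i ᵥ* (bigAv d n * stackMat n fun j => (D.Abar + ΔA) ^ ((j : ℕ) + 1))) ≤
      D.tw p n i :=
  dualNorm_le_maxOver (D.isCompact_powFamilies n)
    (v := fun Δ => D.F n i ᵥ* (bigAv d n * stackMat n Δ))
    (x := fun j => (D.Abar + ΔA) ^ ((j : ℕ) + 1))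
    (continuous_vecMul_mul _ _ (continuous_stackMat n))
    fun _ => D.pow_mem_PApow hΔA _

theorem dualNorm_le_tδA (hΔA : ΔA ∈ D.PA) :
    dualNorm p (D.F n i ᵥ* (D.bigA1 n * (1 : Matrix (Fin n) (Fin n) ℝ) ⊗ₖ ΔA)) ≤ D.tδA p n i :=
  dualNorm_le_maxOver D.isCompact_PA
    (continuous_vecMul_mul _ _ (continuous_one_kronecker n)) hΔA

theorem dualNorm_le_tδB (hΔB : ΔB ∈ D.PB) :
    dualNorm p (D.F n i ᵥ* (D.bigA1 n * (1 : Matrix (Fin n) (Fin n) ℝ) ⊗ₖ ΔB)) ≤ D.tδB p n i :=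
  dualNorm_le_maxOver D.isCompact_PB
    (continuous_vecMul_mul _ _ (continuous_one_kronecker n)) hΔB

theorem t0_nonneg (hΔA : ΔA ∈ D.PA) : 0 ≤ D.t0 p n i :=
  (dualNorm_nonneg _).trans (D.dualNorm_le_t0 p n i hΔA)

theorem t0_mul_le_t1 (hΔA : ΔA ∈ D.PA) :
    D.t0 p n i * inducedNorm p ((1 : Matrix (Fin n) (Fin n) ℝ) ⊗ₖ ΔA) ≤ D.t1 p n i :=
  mul_le_mul_of_nonneg_left (le_maxOver_of_le D.isCompact_PA
    (continuous_inducedNorm.comp (continuous_one_kronecker n)) (fun _ => le_rfl) hΔA)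
    (D.t0_nonneg p n i hΔA)

theorem t0_mul_le_t2 (hΔA : ΔA ∈ D.PA) (hΔB : ΔB ∈ D.PB) :
    D.t0 p n i * inducedNorm p ((1 : Matrix (Fin n) (Fin n) ℝ) ⊗ₖ ΔB) ≤ D.t2 p n i :=
  mul_le_mul_of_nonneg_left (le_maxOver_of_le D.isCompact_PB
    (continuous_inducedNorm.comp (continuous_one_kronecker n)) (fun _ => le_rfl) hΔB)
    (D.t0_nonneg p n i hΔA)

end bounds

end MPCData

namespace MPCData

variable {d m r o rN a na nb : ℕ} (D : MPCData d m r o rN a na nb)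

/-! ### Robust constraint satisfaction along a plan -/

/-- The stack holds the shifted states, so its last block, of index `n - 1`, is the terminal state.
-/
theorem F_inr_dotProduct {n : ℕ} (hn : 0 < n) (i : Fin rN) (x : ℕ → Fin d → ℝ) :
    D.F n (Sum.inr i) ⬝ᵥ stackVec (fun k : Fin n => x (k + 1)) = (D.HN *ᵥ x n) i := by
  simp only [dotProduct, Fintype.sum_prod_type, stackVec, Matrix.mulVec]
  rw [Finset.sum_eq_single ⟨n - 1, by omega⟩]
  · have : n - 1 + 1 = n := by omega
    simp [F, this]
  · intro k _ hk
    refine Finset.sum_eq_zero fun c _ => ?_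
    have : ¬ ((k : ℕ) + 1 = n) := fun h => hk (Fin.ext (by simp only; omega))
    simp [F, this]
  · simp

/-- The worst-case effect of the model errors and of the disturbances on a linear functional of
the stacked states is covered by the offline bounds. -/
theorem row_bound (p : ℝ≥0∞) [Fact (1 ≤ p)] {n : ℕ} (i : (Fin (n - 1) × Fin r) ⊕ Fin rN)
    {ΔA : Matrix (Fin d) (Fin d) ℝ} (hΔA : ΔA ∈ D.PA)
    {ΔB : Matrix (Fin d) (Fin m) ℝ} (hΔB : ΔB ∈ D.PB)
    (M : Matrix (Fin n × Fin m) (Fin n × Fin d) ℝ) {wm : ℝ}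
    {X Ω : Fin n × Fin d → ℝ} {Ub : Fin n × Fin m → ℝ} (hΩ : vnorm p Ω ≤ wm) :
    D.F n i ⬝ᵥ ((D.bigA1 n * (1 : Matrix (Fin n) (Fin n) ℝ) ⊗ₖ ΔA) *ᵥ X
      + (D.bigA1 n * (1 : Matrix (Fin n) (Fin n) ℝ) ⊗ₖ ΔB) *ᵥ (M *ᵥ Ω + Ub)
      + (bigAv d n * stackMat n fun j =>
          (D.Abar + ΔA) ^ ((j : ℕ) + 1) - D.Abar ^ ((j : ℕ) + 1)) *ᵥ
        (((1 : Matrix (Fin n) (Fin n) ℝ) ⊗ₖ ΔA) *ᵥ X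
          + ((1 : Matrix (Fin n) (Fin n) ℝ) ⊗ₖ ΔB) *ᵥ (M *ᵥ Ω + Ub)
          + D.bigB n *ᵥ (M *ᵥ Ω))
      + (bigAv d n * stackMat n fun j => (D.Abar + ΔA) ^ ((j : ℕ) + 1)) *ᵥ Ω) ≤
    D.tδ1 p n i * vnorm p X + D.tδ3 p n i * inducedNorm p M * wm + D.tδ2 p n i * vnorm p Ub
      + D.tw p n i * wm := by
  have hwm : 0 ≤ wm := (vnorm_nonneg _).trans hΩ
  have hM0 := inducedNorm_nonneg (p := p) M
  have hv : vnorm p (M *ᵥ Ω) ≤ inducedNorm p M * wm :=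
    (vnorm_mulVec_le M Ω).trans (mul_le_mul_of_nonneg_left hΩ hM0)
  -- Feedback and nominal input are separated here. The feedback also enters through `bigB`, which
  -- is why its coefficient `tδ3` exceeds `tδ2` by `t3`.
  have hu : vnorm p (M *ᵥ Ω + Ub) ≤ inducedNorm p M * wm + vnorm p Ub :=
    (vnorm_add_le _ _).trans (by gcongr)
  have hu0 : 0 ≤ inducedNorm p M * wm + vnorm p Ub := (vnorm_nonneg _).trans hu
  have hX0 := vnorm_nonneg (p := p) X
  have ht0 := D.t0_nonneg p n i hΔA
  have h1 : D.F n i ⬝ᵥ ((D.bigA1 n * (1 : Matrix (Fin n) (Fin n) ℝ) ⊗ₖ ΔA) *ᵥ X) ≤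
      D.tδA p n i * vnorm p X :=
    (dotProduct_mulVec_le _ _ _).trans
      (mul_le_mul_of_nonneg_right (D.dualNorm_le_tδA p n i hΔA) hX0)
  have h2 : D.F n i ⬝ᵥ ((D.bigA1 n * (1 : Matrix (Fin n) (Fin n) ℝ) ⊗ₖ ΔB) *ᵥ (M *ᵥ Ω + Ub)) ≤
      D.tδB p n i * (inducedNorm p M * wm + vnorm p Ub) := by
    have hB := D.dualNorm_le_tδB p n i hΔB
    exact (dotProduct_mulVec_le _ _ _).trans
      (mul_le_mul hB hu (vnorm_nonneg _) ((dualNorm_nonneg _).trans hB))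
  have h3 : D.F n i ⬝ᵥ ((bigAv d n * stackMat n fun j =>
          (D.Abar + ΔA) ^ ((j : ℕ) + 1) - D.Abar ^ ((j : ℕ) + 1)) *ᵥ
        (((1 : Matrix (Fin n) (Fin n) ℝ) ⊗ₖ ΔA) *ᵥ X
          + ((1 : Matrix (Fin n) (Fin n) ℝ) ⊗ₖ ΔB) *ᵥ (M *ᵥ Ω + Ub)
          + D.bigB n *ᵥ (M *ᵥ Ω))) ≤
      D.t1 p n i * vnorm p X + D.t2 p n i * (inducedNorm p M * wm + vnorm p Ub)
        + D.t3 p n i * (inducedNorm p M * wm) := by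
    refine (dotProduct_mulVec_le (p := p) _ _ _).trans ?_
    refine (mul_le_mul (D.dualNorm_le_t0 p n i hΔA) ((vnorm_add_le (p := p) _ _).trans
      (add_le_add (vnorm_add_le (p := p) _ _) le_rfl)) (vnorm_nonneg _) ht0).trans ?_
    rw [mul_add, mul_add]
    refine add_le_add (add_le_add ?_ ?_) ?_
    · calc _ ≤ D.t0 p n i * (inducedNorm p ((1 : Matrix (Fin n) (Fin n) ℝ) ⊗ₖ ΔA) * vnorm p X) :=
            mul_le_mul_of_nonneg_left (vnorm_mulVec_le _ _) ht0
        _ ≤ _ := by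
            rw [← mul_assoc]
            exact mul_le_mul_of_nonneg_right (D.t0_mul_le_t1 p n i hΔA) hX0
    · calc _ ≤ D.t0 p n i * (inducedNorm p ((1 : Matrix (Fin n) (Fin n) ℝ) ⊗ₖ ΔB) *
              (inducedNorm p M * wm + vnorm p Ub)) :=
            mul_le_mul_of_nonneg_left ((vnorm_mulVec_le _ _).trans
              (mul_le_mul_of_nonneg_left hu (inducedNorm_nonneg _))) ht0
        _ ≤ _ := by
            rw [← mul_assoc]
            exact mul_le_mul_of_nonneg_right (D.t0_mul_le_t2 p n i hΔA hΔB) hu0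
    · calc _ ≤ D.t0 p n i * (inducedNorm p (D.bigB n) * (inducedNorm p M * wm)) :=
            mul_le_mul_of_nonneg_left ((vnorm_mulVec_le _ _).trans
              (mul_le_mul_of_nonneg_left hv (inducedNorm_nonneg _))) ht0
        _ = _ := by rw [t3, mul_assoc]
  have h4 : D.F n i ⬝ᵥ ((bigAv d n * stackMat n fun j =>
      (D.Abar + ΔA) ^ ((j : ℕ) + 1)) *ᵥ Ω) ≤ D.tw p n i * wm := by
    have hw := D.dualNorm_le_tw p n i hΔA
    exact (dotProduct_mulVec_le _ _ _).trans
      (mul_le_mul hw hΩ (vnorm_nonneg _) ((dualNorm_nonneg _).trans hw))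
  rw [dotProduct_add, dotProduct_add, dotProduct_add]
  refine (add_le_add (add_le_add (add_le_add h1 h2) h3) h4).trans (le_of_eq ?_)
  simp only [tδ1, tδ2, tδ3]
  ring

/-- The stacked true states, in terms of the nominal plan and of the model errors. -/
theorem stacked_states {n : ℕ} {ΔA : Matrix (Fin d) (Fin d) ℝ} {ΔB : Matrix (Fin d) (Fin m) ℝ}
    (M : Matrix (Fin n × Fin m) (Fin n × Fin d) ℝ)
    {x xb w : ℕ → Fin d → ℝ} {u ub : ℕ → Fin m → ℝ} (h0 : x 0 = xb 0)
    (hx : ∀ k < n, x (k + 1) = (D.Abar + ΔA) *ᵥ x k + (D.Bbar + ΔB) *ᵥ u k + w k)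
    (hxb : ∀ k < n, xb (k + 1) = D.Abar *ᵥ xb k + D.Bbar *ᵥ ub k)
    (hu : stackVec (fun k : Fin n => u k) =
      M *ᵥ stackVec (fun k : Fin n => w k) + stackVec fun k : Fin n => ub k) :
    stackVec (fun k : Fin n => x (k + 1)) =
      (D.bigA n *ᵥ stackVec (fun k : Fin n => xb k)
        + D.bigB n *ᵥ (M *ᵥ stackVec (fun k : Fin n => w k) + stackVec fun k : Fin n => ub k)
        + ((D.bigA1 n - 1) * D.bigB n * M) *ᵥ stackVec (fun k : Fin n => w k)
        + stackVec fun k : Fin n => w k) +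
      ((D.bigA1 n * (1 : Matrix (Fin n) (Fin n) ℝ) ⊗ₖ ΔA) *ᵥ stackVec (fun k : Fin n => xb k)
      + (D.bigA1 n * (1 : Matrix (Fin n) (Fin n) ℝ) ⊗ₖ ΔB) *ᵥ
        (M *ᵥ stackVec (fun k : Fin n => w k) + stackVec fun k : Fin n => ub k)
      + (bigAv d n * stackMat n fun j =>
          (D.Abar + ΔA) ^ ((j : ℕ) + 1) - D.Abar ^ ((j : ℕ) + 1)) *ᵥ
        (((1 : Matrix (Fin n) (Fin n) ℝ) ⊗ₖ ΔA) *ᵥ stackVec (fun k : Fin n => xb k)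
          + ((1 : Matrix (Fin n) (Fin n) ℝ) ⊗ₖ ΔB) *ᵥ
            (M *ᵥ stackVec (fun k : Fin n => w k) + stackVec fun k : Fin n => ub k)
          + D.bigB n *ᵥ (M *ᵥ stackVec (fun k : Fin n => w k)))
      + (bigAv d n * stackMat n fun j => (D.Abar + ΔA) ^ ((j : ℕ) + 1)) *ᵥ
        stackVec (fun k : Fin n => w k)) := by
  set T0 : Matrix (Fin n × Fin d) (Fin n × Fin d) ℝ := bigAv d n * stackMat n fun j =>
    (D.Abar + ΔA) ^ ((j : ℕ) + 1) - D.Abar ^ ((j : ℕ) + 1) with hT0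
  set Tw : Matrix (Fin n × Fin d) (Fin n × Fin d) ℝ := bigAv d n * stackMat n fun j =>
    (D.Abar + ΔA) ^ ((j : ℕ) + 1) with hTw
  have hT0' : ∀ k l, T0 k l = if l.1 < k.1 then
      ((D.Abar + ΔA) ^ ((k.1 : ℕ) - l.1) - D.Abar ^ ((k.1 : ℕ) - l.1)) k.2 l.2 else 0 :=
    fun k l => bigAv_mul_stackMat (fun j => (D.Abar + ΔA) ^ j - D.Abar ^ j) k l
  have hTw' : ∀ k l, Tw k l = if l.1 < k.1 then
      ((D.Abar + ΔA) ^ ((k.1 : ℕ) - l.1)) k.2 l.2 else 0 :=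
    fun k l => bigAv_mul_stackMat (fun j => (D.Abar + ΔA) ^ j) k l
  -- Both sides are the block lower triangular matrix of powers of the true `Abar + ΔA`. The left
  -- splitting will act on the forcing from model errors and feedback, the right one on the
  -- disturbances.
  have hsum : D.bigA1 n + T0 = 1 + Tw := by
    ext ⟨k, b⟩ ⟨l, c⟩
    rw [Matrix.add_apply, Matrix.add_apply, hT0', hTw']
    rcases lt_trichotomy l k with h | rfl | h
    · simp [bigA1, h, h.le, h.ne']
    · simp [bigA1, Matrix.one_apply]
    · simp [bigA1, h.not_ge, h.not_gt, h.ne]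
  have hT : ∀ k l, (1 + Tw) k l = if l.1 ≤ k.1 then
      ((D.Abar + ΔA) ^ ((k.1 : ℕ) - l.1)) k.2 l.2 else 0 := by
    rintro ⟨k, b⟩ ⟨l, c⟩
    rw [Matrix.add_apply, hTw']
    rcases lt_trichotomy l k with h | rfl | h
    · simp [h, h.le, h.ne']
    · simp [Matrix.one_apply]
    · simp [h.not_ge, h.not_gt, h.ne]
  -- The deviation from the nominal state starts at zero and evolves with the true state matrix. The
  -- model error `ΔA` then acts as forcing on the nominal state only.
  have hsol := lowerTriangular_mulVec_eq (D.Abar + ΔA) (1 + Tw) hT (fun k => x k - xb k)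
    (fun k => ΔA *ᵥ xb k + ΔB *ᵥ u k + D.Bbar *ᵥ (u k - ub k) + w k) (by simp [h0])
    (fun k hk => by
      rw [hx k hk, hxb k hk]
      simp only [Matrix.add_mulVec, Matrix.mulVec_sub]
      abel)
  have hnom : stackVec (fun k : Fin n => xb (k + 1)) =
      D.bigA n *ᵥ stackVec (fun k : Fin n => xb k)
        + D.bigB n *ᵥ stackVec (fun k : Fin n => ub k) := by
    rw [bigA, bigB, one_kronecker_mulVec, one_kronecker_mulVec, stackVec_add]
    congr 1
    ext k : 1
    exact hxb k k.2
  have hg : stackVec (fun k : Fin n =>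
        ΔA *ᵥ xb k + ΔB *ᵥ u k + D.Bbar *ᵥ (u k - ub k) + w k) =
      ((1 : Matrix (Fin n) (Fin n) ℝ) ⊗ₖ ΔA) *ᵥ stackVec (fun k : Fin n => xb k)
        + ((1 : Matrix (Fin n) (Fin n) ℝ) ⊗ₖ ΔB) *ᵥ stackVec (fun k : Fin n => u k)
        + D.bigB n *ᵥ (stackVec (fun k : Fin n => u k) - stackVec fun k : Fin n => ub k)
        + stackVec fun k : Fin n => w k := by
    rw [show (stackVec (fun k : Fin n => u k) - stackVec fun k : Fin n => ub k) =
      stackVec fun k : Fin n => u k - ub k from rfl, bigB, one_kronecker_mulVec,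
      one_kronecker_mulVec, one_kronecker_mulVec]
    rfl
  have hdiff : stackVec (fun k : Fin n => x (k + 1)) =
      stackVec (fun k : Fin n => xb (k + 1)) + stackVec fun k : Fin n => x (k + 1) - xb (k + 1) := by
    ext k
    simp [stackVec]
  rw [hdiff, ← hsol, hg, hu, hnom, add_sub_cancel_right]
  generalize stackVec (fun k : Fin n => w k) = Ω
  generalize stackVec (fun k : Fin n => ub k) = Ub
  generalize stackVec (fun k : Fin n => xb k) = X
  have hA : ∀ y, (1 + Tw) *ᵥ y = D.bigA1 n *ᵥ y + T0 *ᵥ y := fun y => by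
    rw [← hsum, Matrix.add_mulVec]
  rw [Matrix.mulVec_add (1 + Tw), hA, Matrix.add_mulVec 1 Tw Ω, Matrix.one_mulVec]
  simp only [← Matrix.mulVec_mulVec, Matrix.sub_mulVec, Matrix.one_mulVec, Matrix.mulVec_add]
  abel

/-- Strict block lower triangularity kills the terms with `l ≥ k`, so the causal policy agrees with
the full matrix product. -/
theorem stackVec_input {n : ℕ} (z : Decision d m n)
    (hM : ∀ (k l : Fin n) (i : Fin m) (c : Fin d), k ≤ l → z.M (k, i) (l, c) = 0)
    (w : ℕ → Fin d → ℝ) :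
    stackVec (fun k : Fin n => z.input w k) =
      z.M *ᵥ stackVec (fun k : Fin n => w k) + stackVec z.ubar := by
  ext ⟨k, i⟩
  simp only [stackVec, Decision.input, Pi.add_apply, Matrix.mulVec, dotProduct,
    Fintype.sum_prod_type]
  congr 1
  refine Finset.sum_subset (Finset.subset_univ _) fun l _ hl => ?_
  refine Finset.sum_eq_zero fun c _ => ?_
  rw [hM k l i c (not_lt.1 fun h => hl (Finset.mem_Iio.2 h)), zero_mul]

/-- An admissible plan that is followed for its whole horizon leads to the terminal set. -/
theorem mem_XN_of_plan (p : ℝ≥0∞) [Fact (1 ≤ p)] (hwmax : D.DisturbanceBound p) {n : ℕ}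
    (hn : 0 < n) (hnN : n ≤ D.N)
    {ΔA : Matrix (Fin d) (Fin d) ℝ} (hΔA : ΔA ∈ D.PA)
    {ΔB : Matrix (Fin d) (Fin m) ℝ} (hΔB : ΔB ∈ D.PB)
    {x w : ℕ → Fin d → ℝ} {u : ℕ → Fin m → ℝ} {z : Decision d m n}
    (hz : D.Admissible p (x 0) z) (hw : ∀ k < n, w k ∈ D.W)
    (hx : ∀ k < n, x (k + 1) = (D.Abar + ΔA) *ᵥ x k + (D.Bbar + ΔB) *ᵥ u k + w k)
    (hu : ∀ k : Fin n, u k = z.input w k) : x n ∈ D.XN := by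
  obtain ⟨hM, hz0, hnom, hcon, -⟩ := hz
  split_ifs at hcon with h1
  · subst h1
    have h := hcon (w 0) (hw 0 one_pos) ΔA hΔA ΔB hΔB 0
    have hu0 : u 0 = z.ubar 0 := by
      have := hu 0
      rw [Fin.val_zero] at this
      rw [this]
      ext i
      have hempty : Finset.Iio (0 : Fin 1) = ∅ := rfl
      simp [Decision.input, hempty]
    rw [XN, Set.mem_ofPred_eq, hx 0 one_pos, hu0]
    rwa [Fin.castSucc_zero, hz0] at h
  · intro i
    set xb : ℕ → Fin d → ℝ := fun k => if h : k < n + 1 then z.xbar ⟨k, h⟩ else 0 with hxb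
    set ub : ℕ → Fin m → ℝ := fun k => if h : k < n then z.ubar ⟨k, h⟩ else 0 with hub
    have hub' : (fun k : Fin n => ub k) = z.ubar := by
      ext k : 1
      simp [hub]
    have hxb' : (fun k : Fin n => xb k) = fun k : Fin n => z.xbar k.castSucc := by
      ext k : 1
      simp [hxb, Fin.castSucc, Fin.castAdd, Fin.castLE]
    have hst := D.stacked_states (ΔA := ΔA) (ΔB := ΔB) z.M (x := x) (xb := xb) (w := w)
      (u := u) (ub := ub) (by simp [hxb, ← hz0]) hx
      (fun k hk => by
        have := hnom ⟨k, hk⟩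
        simpa [hxb, hub, hk, hk.le, Fin.castSucc, Fin.castAdd, Fin.castLE]
          using this)
      (by
        rw [hub', ← stackVec_input z hM]
        congr 1
        ext k : 1
        exact hu k)
    have hΩ := hwmax n hnN (fun k => w k) fun k => hw k k.2
    have hrow := D.row_bound p (Sum.inr i) hΔA hΔB z.M
      (X := stackVec fun k : Fin n => z.xbar k.castSucc) (Ub := stackVec z.ubar) hΩ
    have hc := hcon (fun k => w k) (fun k => hw k k.2) (Sum.inr i)
    rw [← D.F_inr_dotProduct hn, hst, hxb', hub', dotProduct_add]
    -- The row bound is exactly what `ftight` subtracts, so only the untightened right-hand side is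
    -- left.
    refine (add_le_add hc hrow).trans (le_of_eq ?_)
    simp only [ftight, f]
    ring

end MPCData

namespace MPCData

variable {d m r o rN a na nb : ℕ} {D : MPCData d m r o rN a na nb}

/-! ### The problem of horizon one -/

/-- Feasible inputs of the problem of horizon `1`. -/
def OneStep (D : MPCData d m r o rN a na nb) (x : Fin d → ℝ) (v : Fin m → ℝ) : Prop :=
  v ∈ D.U ∧ ∀ w ∈ D.W, ∀ ΔA ∈ D.PA, ∀ ΔB ∈ D.PB,
    (D.Abar + ΔA) *ᵥ x + (D.Bbar + ΔB) *ᵥ v + w ∈ D.XN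

/-- The cost of the problem of horizon `1`. -/
def oneCost (D : MPCData d m r o rN a na nb) (x : Fin d → ℝ) (v : Fin m → ℝ) : ℝ :=
  x ⬝ᵥ (D.P *ᵥ x) + (D.Abar *ᵥ x + D.Bbar *ᵥ v) ⬝ᵥ (D.PN *ᵥ (D.Abar *ᵥ x + D.Bbar *ᵥ v))
    + v ⬝ᵥ (D.R *ᵥ v)

variable {p : ℝ≥0∞} [Fact (1 ≤ p)]

/-- For horizon one, strict triangularity forces `M = 0`, and the problem reduces to the choice of
one input. The horizon enters through an equation because `D.horizon t` is 1 only propositionally. A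
disturbance must exist to instantiate the robust input constraint. -/
theorem Admissible.oneStep (hW : D.W.Nonempty) {n : ℕ} (hn : n = 1) {x : Fin d → ℝ}
    {z : Decision d m n} (hz : D.Admissible p x z) :
    D.OneStep x (z.ubar ⟨0, hn ▸ one_pos⟩) ∧
      D.cost z = D.oneCost x (z.ubar ⟨0, hn ▸ one_pos⟩) := by
  subst hn
  obtain ⟨hM, hz0, hnom, hcon, hin⟩ := hz
  rw [if_pos rfl] at hcon
  have h1 := hnom 0
  rw [Fin.castSucc_zero, hz0] at h1
  refine ⟨⟨?_, fun w hw ΔA hΔA ΔB hΔB => ?_⟩, ?_⟩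
  · obtain ⟨w, hw⟩ := hW
    have hM0 : z.M = 0 := by
      ext ⟨k, i⟩ ⟨l, c⟩
      exact hM k l i c (by simp [Subsingleton.elim k l])
    have h := hin (fun _ => w) (fun _ => hw) 0
    rw [hM0, Matrix.zero_mulVec, zero_add] at h
    exact h
  · have h := hcon w hw ΔA hΔA ΔB hΔB 0
    rw [Fin.castSucc_zero, hz0] at h
    exact h
  · have h2 : z.xbar (Fin.last 1) = D.Abar *ᵥ x + D.Bbar *ᵥ z.ubar 0 := h1
    simp only [cost, oneCost, Fin.sum_univ_one, h2, Fin.castSucc_zero, hz0]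
    rfl

theorem OneStep.exists_admissible {x : Fin d → ℝ} {v : Fin m → ℝ} (h : D.OneStep x v) :
    ∃ z : Decision d m 1, D.Admissible p x z ∧ D.cost z = D.oneCost x v := by
  refine ⟨⟨0, ![x, D.Abar *ᵥ x + D.Bbar *ᵥ v], fun _ => v⟩, ⟨by simp, rfl, ?_, ?_, ?_⟩, ?_⟩
  · intro k
    rw [Subsingleton.elim k 0]
    rfl
  · rw [if_pos rfl]
    intro w hw ΔA hΔA ΔB hΔB k
    rw [Subsingleton.elim k 0]
    exact h.2 w hw ΔA hΔA ΔB hΔB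
  · intro ω _ k
    rw [Matrix.zero_mulVec, zero_add]
    exact h.1
  · simp only [cost, oneCost, Fin.sum_univ_one]
    rfl

theorem value_one_eq (hW : D.W.Nonempty) (x : Fin d → ℝ) :
    D.value p 1 x = sInf {c | ∃ v, D.OneStep x v ∧ c = D.oneCost x v} := by
  unfold value
  congr 1
  ext c
  constructor
  · rintro ⟨z, hz, rfl⟩
    exact ⟨_, hz.oneStep hW rfl⟩
  · rintro ⟨v, hv, rfl⟩
    obtain ⟨z, hz, hc⟩ := hv.exists_admissible (p := p)
    exact ⟨z, hz, hc.symm⟩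

/-- The terminal feedback serves both as the witness of feasibility in `XN` and as the test input
bounding the value from above. -/
theorem oneStep_gain (hinv : D.IsRobustInvariant D.XN) {x : Fin d → ℝ} (hx : x ∈ D.XN) :
    D.OneStep x (D.K *ᵥ x) := by
  refine ⟨(hinv.1 x hx).2, fun w hw ΔA hΔA ΔB hΔB => ?_⟩
  have h := hinv.2 x hx ΔA hΔA ΔB hΔB w hw
  rwa [Matrix.add_mulVec, ← Matrix.mulVec_mulVec] at h

theorem feasible_one (hinv : D.IsRobustInvariant D.XN) {x : Fin d → ℝ} (hx : x ∈ D.XN) :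
    D.Feasible p 1 x :=
  let ⟨z, hz, _⟩ := (oneStep_gain hinv hx).exists_admissible (p := p)
  ⟨z, hz⟩

/-! ### Recursive feasibility of the closed loop -/

theorem horizon_eq_one {t : ℕ} (ht : D.N ≤ t + 1) : D.horizon t = 1 :=
  if_neg (by omega)

theorem horizon_eq_sub {t : ℕ} (ht : t < D.N) : D.horizon t = D.N - t := by
  unfold horizon
  split_ifs <;> omega

section ClosedLoop

variable {ΔA : Matrix (Fin d) (Fin d) ℝ} {ΔB : Matrix (Fin d) (Fin m) ℝ} {s : ℕ}
  {x : ℕ → Fin d → ℝ} {u : ℕ → Fin m → ℝ} {w : ℕ → Fin d → ℝ}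
  {z : (t : ℕ) → Decision d m (D.horizon t)}

/-- If a plan is not replaced by a new one during its horizon, it leads to the terminal set. -/
theorem IsClosedLoop.mem_XN_of_not_feasible (h : D.IsClosedLoop p ΔA ΔB s x u w z)
    (hwmax : D.DisturbanceBound p) (hN : 1 ≤ D.N) (hΔA : ΔA ∈ D.PA) (hΔB : ΔB ∈ D.PB)
    {t : ℕ} (hst : s ≤ t) (hfeas : D.Feasible p (D.horizon t) (x t))
    (hnot : ∀ j, t < j → j < t + D.horizon t → ¬ D.Feasible p (D.horizon j) (x j)) :
    x (t + D.horizon t) ∈ D.XN := by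
  have hhor : D.horizon t ≤ D.N := by
    unfold horizon
    split_ifs <;> omega
  refine D.mem_XN_of_plan p hwmax (D.horizon_pos t) hhor hΔA hΔB (x := fun k => x (t + k))
    (w := fun k => w (t + k)) (u := fun k => u (t + k)) (z := z t) (h.optimal t hst hfeas).1
    (fun k _ => h.disturbance _ (by omega)) (fun k _ => h.dynamics (t + k) (by omega)) ?_
  intro k
  -- At the first step the feedback sum is empty, so the MPC input is the planned one; later steps
  -- are the backup law.
  rcases Nat.eq_zero_or_pos (k : ℕ) with hk | hk
  · have hk0 : k = ⟨0, D.horizon_pos t⟩ := Fin.ext hk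
    have hempty : Finset.Iio k = ∅ := by
      ext l
      simp [Fin.lt_def, hk]
    have hu := h.mpc t hst hfeas
    rw [← hk0] at hu
    simp only [hk, add_zero, hu]
    ext i
    simp [Decision.input, hempty]
  · have hk2 := k.2
    have hb := h.backup (t + k) (by omega) (hnot _ (by omega) (by omega)) t hst (by omega) hfeas
      (fun j hj hj' => hnot j hj (by omega)) (by simp)
    rw [hb]
    congr 1
    exact Fin.ext (by simp)

/-- A plan of horizon one is always carried out in full: there are no intermediate times at which it
could be replaced. -/
theorem IsClosedLoop.mem_XN_add (h : D.IsClosedLoop p ΔA ΔB s x u w z)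
    (hwmax : D.DisturbanceBound p) (hN : 1 ≤ D.N) (hΔA : ΔA ∈ D.PA) (hΔB : ΔB ∈ D.PB)
    (hinv : D.IsRobustInvariant D.XN)
    {t : ℕ} (hst : s ≤ t) (ht : D.N ≤ t + 1) (hx : x t ∈ D.XN) (k : ℕ) : x (t + k) ∈ D.XN := by
  induction k with
  | zero => exact hx
  | succ k ih =>
    have h1 : D.horizon (t + k) = 1 := horizon_eq_one (by omega)
    have := h.mem_XN_of_not_feasible hwmax hN hΔA hΔB (t := t + k) (by omega)
      (by rw [h1]; exact feasible_one hinv ih) (fun j hj hj' => by omega)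
    rwa [h1] at this

theorem IsClosedLoop.mem_XN (h : D.IsClosedLoop p ΔA ΔB 0 x u w z)
    (hwmax : D.DisturbanceBound p) (hN : 1 ≤ D.N) (hΔA : ΔA ∈ D.PA) (hΔB : ΔB ∈ D.PB)
    (hinv : D.IsRobustInvariant D.XN) (hfeas : D.Feasible p D.N (x 0)) {t : ℕ} (ht : D.N ≤ t) :
    x t ∈ D.XN := by
  classical
  let Q : ℕ → Prop := fun j => D.Feasible p (D.horizon j) (x j)
  have h0 : Q 0 := by
    simp only [Q]
    rwa [horizon_eq_sub (by omega), Nat.sub_zero]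
  set τ := Nat.findGreatest Q (D.N - 1) with hτ
  have hQ : Q τ := Nat.findGreatest_spec (Nat.zero_le _) h0
  have hle : τ ≤ D.N - 1 := Nat.findGreatest_le _
  have hhor : D.horizon τ = D.N - τ := horizon_eq_sub (by omega)
  have hxN : x D.N ∈ D.XN := by
    have := h.mem_XN_of_not_feasible hwmax hN hΔA hΔB (Nat.zero_le τ) hQ
      (fun j hj hj' => Nat.findGreatest_is_greatest hj (by omega))
    rwa [hhor, Nat.add_sub_cancel' (by omega)] at this
  have := h.mem_XN_add hwmax hN hΔA hΔB hinv (Nat.zero_le _) (Nat.le_succ _) hxN (t - D.N)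
  rwa [Nat.add_sub_cancel' ht] at this

end ClosedLoop

end MPCData

/-! ### Quadratic forms -/

section Quadratic

variable {p : ℝ≥0∞} [Fact (1 ≤ p)] {ι κ : Type} [Fintype ι] [Fintype κ]

theorem quadratic_pos {Q : Matrix ι ι ℝ} (hQ : Q.PosDef) {x : ι → ℝ} (hx : x ≠ 0) :
    0 < x ⬝ᵥ (Q *ᵥ x) := by
  simpa using hQ.dotProduct_mulVec_pos hx

theorem quadratic_nonneg {Q : Matrix ι ι ℝ} (hQ : Q.PosDef) (x : ι → ℝ) :
    0 ≤ x ⬝ᵥ (Q *ᵥ x) := by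
  rcases eq_or_ne x 0 with rfl | hx
  · simp
  · exact (quadratic_pos hQ hx).le

theorem continuous_quadratic (Q : Matrix ι ι ℝ) : Continuous fun x : ι → ℝ => x ⬝ᵥ (Q *ᵥ x) :=
  continuous_id.dotProduct (continuous_const.matrix_mulVec continuous_id)

theorem quadratic_add (Q : Matrix ι ι ℝ) (x y : ι → ℝ) :
    (x + y) ⬝ᵥ (Q *ᵥ (x + y)) =
      x ⬝ᵥ (Q *ᵥ x) + x ⬝ᵥ (Q *ᵥ y) + y ⬝ᵥ (Q *ᵥ x) + y ⬝ᵥ (Q *ᵥ y) := by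
  rw [Matrix.mulVec_add, add_dotProduct, dotProduct_add, dotProduct_add]
  ring

theorem quadratic_convex {Q : Matrix ι ι ℝ} (hQ : Q.PosDef) (x y : ι → ℝ) {a b : ℝ}
    (ha : 0 ≤ a) (hb : 0 ≤ b) (hab : a + b = 1) :
    (a • x + b • y) ⬝ᵥ (Q *ᵥ (a • x + b • y)) ≤ a * (x ⬝ᵥ (Q *ᵥ x)) + b * (y ⬝ᵥ (Q *ᵥ y)) := by
  -- The gap in the convexity inequality equals `a * b` times the form at `x - y`, by symmetric
  -- cancellation of the cross terms.
  have h := mul_nonneg (mul_nonneg ha hb) (quadratic_nonneg hQ (x - y))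
  have hb' : b = 1 - a := by linarith
  subst hb'
  simp only [Matrix.mulVec_add, Matrix.mulVec_sub, Matrix.mulVec_smul, add_dotProduct,
    dotProduct_add, sub_dotProduct, dotProduct_sub, smul_dotProduct, dotProduct_smul,
    smul_eq_mul] at h ⊢
  linarith

theorem dotProduct_mulVec_le_sum (Q : Matrix ι κ ℝ) (x : ι → ℝ) (y : κ → ℝ) :
    x ⬝ᵥ (Q *ᵥ y) ≤ (∑ i, ∑ j, |Q i j|) * (vnorm p x * vnorm p y) := by
  simp only [dotProduct, Matrix.mulVec, Finset.mul_sum, Finset.sum_mul]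
  refine Finset.sum_le_sum fun i _ => Finset.sum_le_sum fun j _ => (le_abs_self _).trans ?_
  rw [abs_mul, abs_mul]
  calc |x i| * (|Q i j| * |y j|) = |Q i j| * (|x i| * |y j|) := by ring
    _ ≤ _ := mul_le_mul_of_nonneg_left (mul_le_mul (abs_apply_le_vnorm x i)
      (abs_apply_le_vnorm y j) (abs_nonneg _) (vnorm_nonneg _)) (abs_nonneg _)

theorem exists_quadratic_lower_bound (p : ℝ≥0∞) [Fact (1 ≤ p)] {Q : Matrix ι ι ℝ}
    (hQ : Q.PosDef) : ∃ c > 0, ∀ x : ι → ℝ, c * vnorm p x ^ 2 ≤ x ⬝ᵥ (Q *ᵥ x) := by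
  set S : Set (ι → ℝ) := vnorm p ⁻¹' {1} with hS
  have hcpt : IsCompact S := by
    refine Metric.isCompact_of_isClosed_isBounded
      (isClosed_singleton.preimage continuous_vnorm)
      ((Metric.isBounded_closedBall (x := 0) (r := 1)).subset fun x hx => ?_)
    rw [mem_closedBall_zero_iff, pi_norm_le_iff_of_nonneg zero_le_one]
    exact fun i => (abs_apply_le_vnorm x i).trans (le_of_eq hx)
  have key : ∃ c > 0, ∀ x ∈ S, c ≤ x ⬝ᵥ (Q *ᵥ x) := by
    -- The unit sphere is empty when the index type is.
    rcases S.eq_empty_or_nonempty with h | h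
    · exact ⟨1, one_pos, by simp [h]⟩
    · obtain ⟨y, hy, hmin⟩ := hcpt.exists_isMinOn h (continuous_quadratic Q).continuousOn
      refine ⟨_, quadratic_pos hQ ?_, fun x hx => hmin hx⟩
      rintro rfl
      have : vnorm p (0 : ι → ℝ) = 1 := hy
      simp [vnorm_zero] at this
  obtain ⟨c, hc, h⟩ := key
  refine ⟨c, hc, fun x => ?_⟩
  rcases eq_or_ne x 0 with rfl | hx
  · simp [vnorm_zero]
  have hpos : 0 < vnorm p x :=
    lt_of_le_of_ne (vnorm_nonneg x) fun h => hx (vnorm_eq_zero.1 h.symm)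
  have hxS : (vnorm p x)⁻¹ • x ∈ S := by
    change vnorm p ((vnorm p x)⁻¹ • x) = 1
    rw [vnorm_smul, abs_of_pos (inv_pos.2 hpos), inv_mul_cancel₀ hpos.ne']
  have := h _ hxS
  rw [Matrix.mulVec_smul, smul_dotProduct, dotProduct_smul, smul_eq_mul, smul_eq_mul,
    ← mul_assoc, ← mul_inv, ← sq, ← div_eq_inv_mul, le_div_iff₀ (by positivity)] at this
  exact this

end Quadratic

/-- At a point of a polyhedron, short multiples of feasible directions are feasible. -/
theorem exists_forall_polyhedron_scale {d r : ℕ} (H : Matrix (Fin r) (Fin d) ℝ) (h : Fin r → ℝ)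
    {x : Fin d → ℝ} (hx : H *ᵥ x ≤ h) :
    ∃ δ > 0, ∀ v, H *ᵥ (x + v) ≤ h → ∀ t : ℝ, 0 ≤ t → t * ‖v‖ ≤ δ → H *ᵥ (x + t • v) ≤ h := by
  have key : ∀ i, ∀ᶠ δ in nhdsWithin (0 : ℝ) (Set.Ioi 0), ∀ v, H *ᵥ (x + v) ≤ h →
      ∀ t : ℝ, 0 ≤ t → t * ‖v‖ ≤ δ → (H *ᵥ (x + t • v)) i ≤ h i := by
    intro i
    -- An active row does not increase along a feasible direction, so any multiple is allowed, even
    -- beyond 1. An inactive row has slack, which limits only the length of the step.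
    rcases (hx i).eq_or_lt with heq | hlt
    · refine Filter.Eventually.of_forall fun δ v hv t ht _ => ?_
      have hvi := hv i
      rw [Matrix.mulVec_add, Pi.add_apply, heq] at hvi
      rw [Matrix.mulVec_add, Matrix.mulVec_smul, Pi.add_apply, Pi.smul_apply, smul_eq_mul, heq]
      have := mul_nonpos_of_nonneg_of_nonpos ht (show (H *ᵥ v) i ≤ 0 by linarith)
      linarith
    · have hcont : Continuous fun y : Fin d → ℝ => (H *ᵥ y) i :=
        (continuous_apply i).comp (continuous_const.matrix_mulVec continuous_id)
      obtain ⟨ε, hε, hball⟩ := Metric.mem_nhds_iff.1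
        ((isOpen_Iio.preimage hcont).mem_nhds (show x ∈ _ from hlt))
      filter_upwards [Ioo_mem_nhdsGT hε] with δ hδ v _ t ht htv
      refine le_of_lt (show x + t • v ∈ (fun y : Fin d → ℝ => (H *ᵥ y) i) ⁻¹' Set.Iio (h i) from
        hball ?_)
      rw [mem_ball_iff_norm, add_sub_cancel_left, norm_smul, Real.norm_of_nonneg ht]
      exact htv.trans_lt hδ.2
  obtain ⟨δ, hδ, hpos⟩ := ((Filter.eventually_all.2 key).and self_mem_nhdsWithin).exists
  exact ⟨δ, hpos, fun v hv t ht htv i => hδ i v hv t ht htv⟩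

namespace MPCData

variable {d m r o rN a na nb : ℕ} {D : MPCData d m r o rN a na nb} {p : ℝ≥0∞} [Fact (1 ≤ p)]

/-! ### The value function of horizon one -/

theorem isClosed_XN : IsClosed D.XN :=
  isClosed_Iic.preimage (continuous_const.matrix_mulVec continuous_id)

theorem isClosed_U : IsClosed D.U :=
  isClosed_Iic.preimage (continuous_const.matrix_mulVec continuous_id)

theorem isCompact_XN (hinv : D.IsRobustInvariant D.XN) (hX : IsCompact D.X) : IsCompact D.XN :=
  hX.of_isClosed_subset isClosed_XN fun x hx => (hinv.1 x hx).1

theorem convex_XN : Convex ℝ D.XN := by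
  intro x hx y hy α β hα hβ hαβ
  have := (convex_Iic (𝕜 := ℝ) D.hN) (x := D.HN *ᵥ x) hx (y := D.HN *ᵥ y) hy hα hβ hαβ
  simpa [XN, Matrix.mulVec_add, Matrix.mulVec_smul] using this

theorem convex_U : Convex ℝ D.U := by
  intro x hx y hy α β hα hβ hαβ
  have := (convex_Iic (𝕜 := ℝ) D.hu) (x := D.Hu *ᵥ x) hx (y := D.Hu *ᵥ y) hy hα hβ hαβ
  simpa [U, Matrix.mulVec_add, Matrix.mulVec_smul] using this

theorem isClosed_oneStep :
    IsClosed {q : (Fin d → ℝ) × (Fin m → ℝ) | D.OneStep q.1 q.2} := by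
  have h : {q : (Fin d → ℝ) × (Fin m → ℝ) | D.OneStep q.1 q.2} =
      Prod.snd ⁻¹' D.U ∩ ⋂ w ∈ D.W, ⋂ ΔA ∈ D.PA, ⋂ ΔB ∈ D.PB,
        (fun q => (D.Abar + ΔA) *ᵥ q.1 + (D.Bbar + ΔB) *ᵥ q.2 + w) ⁻¹' D.XN := by
    ext q
    simp [OneStep]
  rw [h]
  refine (isClosed_U.preimage continuous_snd).inter ?_
  refine isClosed_biInter fun w _ => isClosed_biInter fun ΔA _ => isClosed_biInter fun ΔB _ =>
    isClosed_XN.preimage ?_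
  exact ((continuous_const.matrix_mulVec continuous_fst).add
    (continuous_const.matrix_mulVec continuous_snd)).add continuous_const

theorem continuous_oneCost :
    Continuous fun q : (Fin d → ℝ) × (Fin m → ℝ) => D.oneCost q.1 q.2 := by
  have hnext : Continuous fun q : (Fin d → ℝ) × (Fin m → ℝ) => D.Abar *ᵥ q.1 + D.Bbar *ᵥ q.2 :=
    (continuous_const.matrix_mulVec continuous_fst).add
      (continuous_const.matrix_mulVec continuous_snd)
  exact (((continuous_quadratic D.P).comp continuous_fst).add
    ((continuous_quadratic D.PN).comp hnext)).add ((continuous_quadratic D.R).comp continuous_snd)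

theorem OneStep.convex {x y : Fin d → ℝ} {v v' : Fin m → ℝ} (h : D.OneStep x v)
    (h' : D.OneStep y v') {α β : ℝ} (hα : 0 ≤ α) (hβ : 0 ≤ β) (hαβ : α + β = 1) :
    D.OneStep (α • x + β • y) (α • v + β • v') := by
  refine ⟨convex_U h.1 h'.1 hα hβ hαβ, fun w hw ΔA hΔA ΔB hΔB => ?_⟩
  have := convex_XN (h.2 w hw ΔA hΔA ΔB hΔB) (h'.2 w hw ΔA hΔA ΔB hΔB) hα hβ hαβ
  convert this using 1
  have hw' : w = α • w + β • w := by rw [← add_smul, hαβ, one_smul]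
  conv_lhs => rw [hw']
  simp only [Matrix.mulVec_add, Matrix.mulVec_smul, smul_add]
  abel

theorem oneCost_nonneg (hP : D.P.PosDef) (hR : D.R.PosDef) (hPN : D.PN.PosDef)
    (x : Fin d → ℝ) (v : Fin m → ℝ) : 0 ≤ D.oneCost x v :=
  add_nonneg (add_nonneg (quadratic_nonneg hP _) (quadratic_nonneg hPN _)) (quadratic_nonneg hR _)

theorem oneCost_convex (hP : D.P.PosDef) (hR : D.R.PosDef) (hPN : D.PN.PosDef)
    (x y : Fin d → ℝ) (v v' : Fin m → ℝ) {α β : ℝ} (hα : 0 ≤ α) (hβ : 0 ≤ β)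
    (hαβ : α + β = 1) :
    D.oneCost (α • x + β • y) (α • v + β • v') ≤ α * D.oneCost x v + β * D.oneCost y v' := by
  have h1 := quadratic_convex hP x y hα hβ hαβ
  have h2 := quadratic_convex hPN (D.Abar *ᵥ x + D.Bbar *ᵥ v) (D.Abar *ᵥ y + D.Bbar *ᵥ v')
    hα hβ hαβ
  have h3 := quadratic_convex hR v v' hα hβ hαβ
  have hnext : D.Abar *ᵥ (α • x + β • y) + D.Bbar *ᵥ (α • v + β • v') =
      α • (D.Abar *ᵥ x + D.Bbar *ᵥ v) + β • (D.Abar *ᵥ y + D.Bbar *ᵥ v') := by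
    simp only [Matrix.mulVec_add, Matrix.mulVec_smul, smul_add]
    abel
  simp only [oneCost, hnext]
  linarith

theorem value_one_nonneg (hP : D.P.PosDef) (hR : D.R.PosDef) (hPN : D.PN.PosDef)
    (hW : D.W.Nonempty) (x : Fin d → ℝ) : 0 ≤ D.value p 1 x := by
  rw [value_one_eq hW]
  refine Real.sInf_nonneg ?_
  rintro _ ⟨v, -, rfl⟩
  exact oneCost_nonneg hP hR hPN x v

theorem value_one_le (hP : D.P.PosDef) (hR : D.R.PosDef) (hPN : D.PN.PosDef)
    (hW : D.W.Nonempty) {x : Fin d → ℝ} {v : Fin m → ℝ} (hv : D.OneStep x v) :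
    D.value p 1 x ≤ D.oneCost x v := by
  rw [value_one_eq hW]
  refine csInf_le ⟨0, ?_⟩ ⟨v, hv, rfl⟩
  rintro _ ⟨v', -, rfl⟩
  exact oneCost_nonneg hP hR hPN x v'

theorem exists_value_one_eq (hW : D.W.Nonempty) (hU : IsCompact D.U)
    (hinv : D.IsRobustInvariant D.XN) {x : Fin d → ℝ} (hx : x ∈ D.XN) :
    ∃ v, D.OneStep x v ∧ D.value p 1 x = D.oneCost x v := by
  have hpair : Continuous fun v : Fin m → ℝ => (x, v) := by fun_prop
  have hcpt : IsCompact {v | D.OneStep x v} :=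
    hU.of_isClosed_subset (isClosed_oneStep.preimage hpair) fun v hv => hv.1
  obtain ⟨v, hv, hmin⟩ := hcpt.exists_isMinOn ⟨_, oneStep_gain hinv hx⟩
    (continuous_oneCost.comp hpair).continuousOn
  refine ⟨v, hv, ?_⟩
  rw [value_one_eq hW]
  refine IsLeast.csInf_eq ⟨⟨v, hv, rfl⟩, ?_⟩
  rintro _ ⟨v', hv', rfl⟩
  exact hmin hv'

/-- With the input `K x`, the cost of one step plus the terminal cost of the nominal successor is at
most the terminal cost of `x`, by the condition on `PN`. -/
theorem value_one_le_terminalCost (hP : D.P.PosDef) (hR : D.R.PosDef) (hPN : D.PN.PosDef)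
    (hW : D.W.Nonempty) (hinv : D.IsRobustInvariant D.XN) (hcost : D.TerminalCostDecrease)
    {x : Fin d → ℝ} (hx : x ∈ D.XN) : D.value p 1 x ≤ x ⬝ᵥ (D.PN *ᵥ x) := by
  refine (value_one_le hP hR hPN hW (oneStep_gain hinv hx)).trans ?_
  have h := hcost x hx
  have hnext : D.Abar *ᵥ x + D.Bbar *ᵥ (D.K *ᵥ x) = (D.Abar + D.Bbar * D.K) *ᵥ x := by
    rw [Matrix.add_mulVec, Matrix.mulVec_mulVec]
  have htr : ∀ {k : ℕ} (G : Matrix (Fin k) (Fin d) ℝ) (Q : Matrix (Fin k) (Fin k) ℝ),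
      x ⬝ᵥ ((Gᵀ * Q * G) *ᵥ x) = (G *ᵥ x) ⬝ᵥ (Q *ᵥ (G *ᵥ x)) := by
    intro k G Q
    rw [← Matrix.mulVec_mulVec, ← Matrix.mulVec_mulVec, Matrix.dotProduct_mulVec x Gᵀ,
      Matrix.vecMul_transpose]
  rw [Matrix.add_mulVec, Matrix.add_mulVec, Matrix.add_mulVec, Matrix.neg_mulVec, dotProduct_add,
    dotProduct_add, dotProduct_add, dotProduct_neg, htr, htr] at h
  rw [oneCost, hnext]
  linarith

/-- Since minimizers exist, a sublevel set of the value in `XN` is the projection of a compact set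
of state-input pairs, hence closed. -/
theorem lowerSemicontinuousOn_value_one (hP : D.P.PosDef) (hR : D.R.PosDef) (hPN : D.PN.PosDef)
    (hW : D.W.Nonempty) (hX : IsCompact D.X) (hU : IsCompact D.U)
    (hinv : D.IsRobustInvariant D.XN) : LowerSemicontinuousOn (D.value p 1) D.XN := by
  intro x _ c hc
  set S : Set ((Fin d → ℝ) × (Fin m → ℝ)) :=
    (D.XN ×ˢ D.U) ∩ ({q | D.OneStep q.1 q.2} ∩ {q | D.oneCost q.1 q.2 ≤ c}) with hS
  have hcpt : IsCompact S := ((isCompact_XN hinv hX).prod hU).inter_right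
    (isClosed_oneStep.inter (isClosed_le continuous_oneCost continuous_const))
  have hclosed : IsClosed (Prod.fst '' S) := (hcpt.image continuous_fst).isClosed
  have hxS : x ∉ Prod.fst '' S := by
    rintro ⟨⟨y, v⟩, ⟨-, hv, hle⟩, rfl⟩
    exact absurd (hc.trans_le (value_one_le hP hR hPN hW hv)) (not_lt.2 hle)
  filter_upwards [self_mem_nhdsWithin,
    mem_nhdsWithin_of_mem_nhds (hclosed.isOpen_compl.mem_nhds hxS)] with y hy hyS
  by_contra hle
  obtain ⟨v, hv, hval⟩ := exists_value_one_eq (p := p) hW hU hinv hy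
  exact hyS ⟨(y, v), ⟨⟨hy, hv.1⟩, hv, hval.ge.trans (not_lt.1 hle)⟩, rfl⟩

/-- Cost and constraints are jointly convex in state and input, and partial minimization preserves
convexity. -/
theorem value_one_convex (hP : D.P.PosDef) (hR : D.R.PosDef) (hPN : D.PN.PosDef)
    (hW : D.W.Nonempty) (hU : IsCompact D.U) (hinv : D.IsRobustInvariant D.XN) :
    ConvexOn ℝ D.XN (D.value p 1) := by
  refine ⟨convex_XN, fun x hx y hy α β hα hβ hαβ => ?_⟩
  obtain ⟨v, hv, hval⟩ := exists_value_one_eq (p := p) hW hU hinv hx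
  obtain ⟨v', hv', hval'⟩ := exists_value_one_eq (p := p) hW hU hinv hy
  rw [hval, hval']
  exact (value_one_le hP hR hPN hW (hv.convex hv' hα hβ hαβ)).trans
    (oneCost_convex hP hR hPN x y v v' hα hβ hαβ)

end MPCData

/-- A convex function that is bounded above on a polyhedron is upper semicontinuous there. -/
theorem ConvexOn.upperSemicontinuousOn_polyhedron {d r : ℕ} {H : Matrix (Fin r) (Fin d) ℝ}
    {h : Fin r → ℝ} {V : (Fin d → ℝ) → ℝ} (hV : ConvexOn ℝ {x | H *ᵥ x ≤ h} V)
    {B : ℝ} (hB : ∀ x, H *ᵥ x ≤ h → V x ≤ B) :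
    UpperSemicontinuousOn V {x | H *ᵥ x ≤ h} := by
  intro x hx c hc
  have hx' : H *ᵥ x ≤ h := hx
  obtain ⟨δ, hδ, hscale⟩ := exists_forall_polyhedron_scale H h hx'
  have hlim : Filter.Tendsto (fun y => V x + ‖y - x‖ / δ * (B - V x)) (nhds x) (nhds (V x)) := by
    have hcont : Continuous fun y => V x + ‖y - x‖ / δ * (B - V x) := by fun_prop
    simpa using hcont.tendsto x
  filter_upwards [self_mem_nhdsWithin, mem_nhdsWithin_of_mem_nhds (hlim.eventually_lt_const hc),
    mem_nhdsWithin_of_mem_nhds (Metric.closedBall_mem_nhds x hδ)] with y hy hlt hball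
  rcases eq_or_ne y x with rfl | hne
  · exact hc
  have hpos : 0 < ‖y - x‖ := norm_pos_iff.2 (sub_ne_zero.2 hne)
  have hle : ‖y - x‖ ≤ δ := by rwa [mem_closedBall_iff_norm] at hball
  set t := ‖y - x‖ / δ with ht
  have ht0 : 0 < t := div_pos hpos hδ
  have ht1 : t ≤ 1 := (div_le_one hδ).2 hle
  -- The segment from `x` through `y` is prolonged to length `δ` inside the polyhedron. Then `y` is
  -- a convex combination giving the far point, where `V ≤ B`, the small weight `t`.
  have hfar : H *ᵥ (x + t⁻¹ • (y - x)) ≤ h := by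
    refine hscale (y - x) (by rwa [add_sub_cancel]) t⁻¹ (inv_nonneg.2 ht0.le) (le_of_eq ?_)
    rw [ht, inv_div, div_mul_cancel₀ _ hpos.ne']
  have hcomb : (1 - t) • x + t • (x + t⁻¹ • (y - x)) = y := by
    rw [smul_add, smul_smul, mul_inv_cancel₀ ht0.ne', one_smul, sub_smul, one_smul]
    abel
  have hconv := hV.2 hx hfar (sub_nonneg.2 ht1) ht0.le (by ring)
  rw [hcomb, smul_eq_mul, smul_eq_mul] at hconv
  have := mul_le_mul_of_nonneg_left (hB _ hfar) ht0.le
  linarith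

namespace MPCData

variable {d m r o rN a na nb : ℕ} {D : MPCData d m r o rN a na nb} {p : ℝ≥0∞} [Fact (1 ≤ p)]

theorem continuousOn_value_one (hP : D.P.PosDef) (hR : D.R.PosDef) (hPN : D.PN.PosDef)
    (hW : D.W.Nonempty) (hX : IsCompact D.X) (hU : IsCompact D.U)
    (hinv : D.IsRobustInvariant D.XN) (hcost : D.TerminalCostDecrease) :
    ContinuousOn (D.value p 1) D.XN := by
  obtain ⟨B, hB⟩ := (isCompact_XN hinv hX).bddAbove_image (continuous_quadratic D.PN).continuousOn
  have husc : UpperSemicontinuousOn (D.value p 1) D.XN :=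
    (value_one_convex hP hR hPN hW hU hinv).upperSemicontinuousOn_polyhedron fun x hx =>
      (value_one_le_terminalCost hP hR hPN hW hinv hcost hx).trans (hB ⟨x, hx, rfl⟩)
  have hlsc := lowerSemicontinuousOn_value_one (p := p) hP hR hPN hW hX hU hinv
  intro x hx
  exact tendsto_order.2 ⟨hlsc x hx, husc x hx⟩

end MPCData

/-! ### Comparison functions -/

theorem isClassKInf_mul_sq {c : ℝ} (hc : 0 < c) : IsClassKInf fun s => c * s ^ 2 := by
  refine ⟨⟨by fun_prop, fun s hs t _ hst => ?_, by simp⟩,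
    (Filter.tendsto_pow_atTop two_ne_zero).const_mul_atTop hc⟩
  exact mul_lt_mul_of_pos_left (pow_lt_pow_left₀ hst hs two_ne_zero) hc

theorem isClassK_linear_add_sq {a b : ℝ} (ha : 0 < a) (hb : 0 < b) :
    IsClassK fun s => a * s + b * s ^ 2 := by
  refine ⟨by fun_prop, fun s hs t _ hst => ?_, by simp⟩
  exact add_lt_add (mul_lt_mul_of_pos_left hst ha)
    (mul_lt_mul_of_pos_left (pow_lt_pow_left₀ hst hs two_ne_zero) hb)

theorem IsClassK.nonneg {σ : ℝ → ℝ} (hσ : IsClassK σ) {s : ℝ} (hs : 0 ≤ s) : 0 ≤ σ s := by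
  have := hσ.2.1.monotoneOn Set.self_mem_Ici hs hs
  rwa [hσ.2.2] at this

theorem IsClassK.sqrt_div {σ : ℝ → ℝ} (hσ : IsClassK σ) {c : ℝ} (hc : 0 < c) :
    IsClassK fun s => √(σ s / c) := by
  refine ⟨(hσ.1.div_const c).sqrt, fun s hs t ht hst => ?_, by simp [hσ.2.2]⟩
  exact Real.sqrt_lt_sqrt (div_nonneg (hσ.nonneg hs) hc.le)
    (div_lt_div_of_pos_right (hσ.2.1 hs ht hst) hc)

theorem isClassKL_mul_rpow {c η : ℝ} (hc : 0 < c) (hη0 : 0 < η) (hη1 : η < 1) :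
    IsClassKL fun r s => c * r * η ^ s := by
  refine ⟨?_, fun s _ => ⟨by fun_prop, fun r _ r' _ hr => ?_, by simp⟩, fun r hr => ⟨?_, ?_⟩⟩
  · have : Continuous fun q : ℝ × ℝ => c * q.1 * η ^ q.2 :=
      (continuous_const.mul continuous_fst).mul
        ((Real.continuous_const_rpow hη0.ne').comp continuous_snd)
    exact this.continuousOn
  · exact mul_lt_mul_of_pos_right (mul_lt_mul_of_pos_left hr hc) (Real.rpow_pos_of_pos hη0 s)
  · intro s _ t _ hst
    exact mul_le_mul_of_nonneg_left (Real.rpow_le_rpow_of_exponent_ge hη0 hη1.le hst)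
      (mul_nonneg hc.le hr)
  · have := (tendsto_rpow_atTop_of_base_lt_one η (by linarith) hη1).const_mul (c * r)
    rwa [mul_zero] at this

/-- A sequence that contracts up to a perturbation stays below a decaying bound plus a gain. -/
theorem contraction_bound {V : ℕ → ℝ} {ρ ε : ℝ} (hρ0 : 0 < ρ) (hρ1 : ρ < 1) {n : ℕ}
    (hε : 0 ≤ ε) (h : ∀ k < n, V (k + 1) ≤ ρ * V k + ε) :
    V n ≤ ρ ^ n * V 0 + ε / (1 - ρ) := by
  have h1 : 0 < 1 - ρ := by linarith
  induction n with
  | zero =>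
    have := div_nonneg hε h1.le
    simpa using this
  | succ n ih =>
    have hn := h n (Nat.lt_succ_self n)
    have := mul_le_mul_of_nonneg_left (ih fun k hk => h k (by omega)) hρ0.le
    -- The gain is the fixed point of `s ↦ ρ * s + ε`.
    have hgeom : ρ * (ε / (1 - ρ)) + ε = ε / (1 - ρ) := by
      field_simp
      ring
    rw [pow_succ']
    linarith

namespace MPCData

variable {d m r o rN a na nb : ℕ} {D : MPCData d m r o rN a na nb} {p : ℝ≥0∞} [Fact (1 ≤ p)]

/-! ### The Lyapunov inequality -/

theorem exists_vnorm_bound {ι : Type} [Fintype ι] {S : Set (ι → ℝ)} (hS : IsCompact S) :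
    ∃ B, ∀ v ∈ S, vnorm p v ≤ B := by
  obtain ⟨B, hB⟩ := hS.bddAbove_image (continuous_vnorm (p := p)).continuousOn
  exact ⟨B, fun v hv => hB ⟨v, hv, rfl⟩⟩

theorem IsOptimal.cost_eq_value (hP : D.P.PosDef) (hR : D.R.PosDef) (hPN : D.PN.PosDef)
    (hW : D.W.Nonempty) {n : ℕ} (hn : n = 1) {x : Fin d → ℝ}
    {z : Decision d m n} (hz : D.IsOptimal p x z) :
    D.OneStep x (z.ubar ⟨0, hn ▸ one_pos⟩) ∧
      D.value p 1 x = D.oneCost x (z.ubar ⟨0, hn ▸ one_pos⟩) := by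
  obtain ⟨hstep, hc⟩ := hz.1.oneStep hW hn
  subst hn
  refine ⟨hstep, le_antisymm (value_one_le hP hR hPN hW hstep) ?_⟩
  rw [← hc]
  refine le_csInf ⟨_, z, hz.1, rfl⟩ ?_
  rintro _ ⟨z', hz', rfl⟩
  exact hz.2 z' hz'

theorem exists_lyapunov_constants (hwmax : D.DisturbanceBound p) (hN : 1 ≤ D.N)
    {ΔA : Matrix (Fin d) (Fin d) ℝ} (hΔA : ΔA ∈ D.PA)
    {ΔB : Matrix (Fin d) (Fin m) ℝ} (hΔB : ΔB ∈ D.PB)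
    (hinv : D.IsRobustInvariant D.XN) (hX : IsCompact D.X) (hU : IsCompact D.U)
    (hW : D.W.Nonempty) (hP : D.P.PosDef) (hR : D.R.PosDef) (hPN : D.PN.PosDef)
    (hcost : D.TerminalCostDecrease) :
    ∃ c₁ c₂ b₁ b₂ : ℝ, 0 < c₁ ∧ c₁ < c₂ ∧ 0 < b₁ ∧ 0 < b₂ ∧
      (∀ x ∈ D.XN, c₁ * vnorm p x ^ 2 ≤ D.value p 1 x ∧ D.value p 1 x ≤ c₂ * vnorm p x ^ 2) ∧
      ∀ s x u w z, D.N ≤ s + 1 → D.IsClosedLoop p ΔA ΔB s x u w z → x s ∈ D.XN → ∀ k : ℕ,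
        D.value p 1 (x (s + k + 1)) ≤ D.value p 1 (x (s + k)) - c₁ * vnorm p (x (s + k)) ^ 2 +
          (b₁ * vnorm p (lumped ΔA ΔB x u w (s + k))
            + b₂ * vnorm p (lumped ΔA ΔB x u w (s + k)) ^ 2) := by
  obtain ⟨c₁, hc₁, hlow⟩ := exists_quadratic_lower_bound p hP
  obtain ⟨bX, hbX⟩ := exists_vnorm_bound (p := p) hX
  obtain ⟨bU, hbU⟩ := exists_vnorm_bound (p := p) hU
  set C := ∑ i, ∑ j, |D.PN i j| with hC
  have hC0 : 0 ≤ C := Finset.sum_nonneg fun i _ => Finset.sum_nonneg fun j _ => abs_nonneg _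
  -- A bound on the nominal successor, used for the cross terms. The absolute value supplies
  -- nonnegativity without sign information on `bX` and `bU`.
  set Y := |inducedNorm p D.Abar * bX + inducedNorm p D.Bbar * bU| with hY
  have hY0 : 0 ≤ Y := abs_nonneg _
  -- Only `C`, `2 * C * Y` and `C` are needed. The surplus makes `c₁ < c₂` strict, so the later
  -- contraction rate is positive, and makes the gain strictly increasing.
  refine ⟨c₁, C + c₁ + 1, 2 * C * Y + 1, C + 1, hc₁, by linarith, by positivity, by positivity,
    fun x hx => ⟨?_, ?_⟩, ?_⟩
  · obtain ⟨v, -, hval⟩ := exists_value_one_eq (p := p) hW hU hinv hx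
    have h1 := hlow x
    have h2 := quadratic_nonneg hPN (D.Abar *ᵥ x + D.Bbar *ᵥ v)
    have h3 := quadratic_nonneg hR v
    rw [hval, oneCost]
    linarith
  · have h1 := value_one_le_terminalCost (p := p) hP hR hPN hW hinv hcost hx
    have h2 := dotProduct_mulVec_le_sum (p := p) D.PN x x
    have h3 := sq_nonneg (vnorm p x)
    rw [← sq, ← hC] at h2
    nlinarith
  · intro s x u w z hs hcl hxs k
    have hk : x (s + k) ∈ D.XN := hcl.mem_XN_add hwmax hN hΔA hΔB hinv le_rfl hs hxs k
    have hk1 : x (s + k + 1) ∈ D.XN := hcl.mem_XN_add hwmax hN hΔA hΔB hinv le_rfl hs hxs (k + 1)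
    have hhor : D.horizon (s + k) = 1 := horizon_eq_one (by omega)
    have hfeas : D.Feasible p (D.horizon (s + k)) (x (s + k)) := by
      rw [hhor]
      exact feasible_one hinv hk
    obtain ⟨hstep, hval⟩ := (hcl.optimal (s + k) (by omega) hfeas).cost_eq_value hP hR hPN hW hhor
    rw [← hcl.mpc (s + k) (by omega) hfeas] at hstep hval
    set y := D.Abar *ᵥ x (s + k) + D.Bbar *ᵥ u (s + k) with hy
    set e := lumped ΔA ΔB x u w (s + k) with he
    have hnext : x (s + k + 1) = y + e := by
      rw [hcl.dynamics (s + k) (by omega), hy, he, lumped, Matrix.add_mulVec, Matrix.add_mulVec]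
      abel
    have hyY : vnorm p y ≤ Y :=
      calc vnorm p y ≤ inducedNorm p D.Abar * vnorm p (x (s + k)) +
            inducedNorm p D.Bbar * vnorm p (u (s + k)) :=
            (vnorm_add_le _ _).trans (add_le_add (vnorm_mulVec_le _ _) (vnorm_mulVec_le _ _))
        _ ≤ inducedNorm p D.Abar * bX + inducedNorm p D.Bbar * bU :=
            add_le_add (mul_le_mul_of_nonneg_left (hbX _ (hinv.1 _ hk).1) (inducedNorm_nonneg _))
              (mul_le_mul_of_nonneg_left (hbU _ hstep.1) (inducedNorm_nonneg _))
        _ ≤ Y := le_abs_self _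
    have hV := value_one_le_terminalCost (p := p) hP hR hPN hW hinv hcost hk1
    rw [hnext, quadratic_add] at hV
    have h1 := dotProduct_mulVec_le_sum (p := p) D.PN y e
    have h2 := dotProduct_mulVec_le_sum (p := p) D.PN e y
    have h3 := dotProduct_mulVec_le_sum (p := p) D.PN e e
    rw [← hC] at h1 h2 h3
    have he0 : 0 ≤ vnorm p e := vnorm_nonneg e
    have h4 : C * (vnorm p y * vnorm p e) ≤ C * (Y * vnorm p e) :=
      mul_le_mul_of_nonneg_left (mul_le_mul_of_nonneg_right hyY he0) hC0
    have h5 := hlow (x (s + k))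
    have h6 := quadratic_nonneg hR (u (s + k))
    have h7 := sq_nonneg (vnorm p e)
    rw [oneCost, ← hy] at hval
    rw [hnext]
    linarith

theorem vnorm_lumped_le_iSup {q : ℝ≥0∞} (ΔA : Matrix (Fin d) (Fin d) ℝ) (ΔB : Matrix (Fin d) (Fin m) ℝ)
    (x : ℕ → Fin d → ℝ) (u : ℕ → Fin m → ℝ) (w : ℕ → Fin d → ℝ) (s : ℕ) {j k : ℕ} (hjk : j ≤ k) :
    vnorm q (lumped ΔA ΔB x u w (s + j)) ≤
      ⨆ i : Fin (k + 1), vnorm q (lumped ΔA ΔB x u w (s + i)) :=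
  le_ciSup (f := fun i : Fin (k + 1) => vnorm q (lumped ΔA ΔB x u w (s + i)))
    (Set.finite_range _).bddAbove ⟨j, Nat.lt_succ_of_le hjk⟩

end MPCData

theorem theorem2 {d m r o rN a na nb : ℕ} (D : MPCData d m r o rN a na nb)
    (p : ℝ≥0∞) [Fact (1 ≤ p)] (hN : 1 ≤ D.N)
    (ΔA : Matrix (Fin d) (Fin d) ℝ) (hΔA : ΔA ∈ D.PA)
    (ΔB : Matrix (Fin d) (Fin m) ℝ) (hΔB : ΔB ∈ D.PB)
    (hwmax : D.DisturbanceBound p)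
    (hK : D.RobustlyStabilizing)
    (hXN : D.TerminalSetMaximal)
    (hX : IsCompact D.X ∧ (0 : Fin d → ℝ) ∈ interior D.X)
    (hU : IsCompact D.U ∧ (0 : Fin m → ℝ) ∈ interior D.U)
    (hW : IsCompact D.W ∧ (0 : Fin d → ℝ) ∈ interior D.W)
    (hP : D.P.PosDef) (hR : D.R.PosDef) (hPN : D.PN.PosDef)
    (hcost : D.TerminalCostDecrease)
    (xS : Fin d → ℝ) (hfeas : D.Feasible p D.N xS) :
    (∀ x u w z, D.IsClosedLoop p ΔA ΔB 0 x u w z → x 0 = xS → ∀ t, D.N ≤ t → x t ∈ D.XN) ∧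
    D.IsISSLyapunov p ΔA ΔB (D.value p 1) ∧
    D.IsISS p ΔA ΔB := by
  have hinv : D.IsRobustInvariant D.XN := hXN.1
  have hW0 : D.W.Nonempty := ⟨0, interior_subset hW.2⟩
  obtain ⟨c₁, c₂, b₁, b₂, hc₁, hc₁₂, hb₁, hb₂, hbd, hdec⟩ :=
    MPCData.exists_lyapunov_constants hwmax hN hΔA hΔB hinv hX.1 hU.1 hW0 hP hR hPN hcost
  have hσ := isClassK_linear_add_sq hb₁ hb₂
  have hgain : ∀ (x : ℕ → Fin d → ℝ) u w s {j k : ℕ}, j ≤ k →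
      b₁ * vnorm p (MPCData.lumped ΔA ΔB x u w (s + j))
        + b₂ * vnorm p (MPCData.lumped ΔA ΔB x u w (s + j)) ^ 2 ≤
      b₁ * (⨆ i : Fin (k + 1), vnorm p (MPCData.lumped ΔA ΔB x u w (s + i)))
        + b₂ * (⨆ i : Fin (k + 1), vnorm p (MPCData.lumped ΔA ΔB x u w (s + i))) ^ 2 := by
    intro x u w s j k hjk
    have hle := MPCData.vnorm_lumped_le_iSup (q := p) ΔA ΔB x u w s hjk
    exact hσ.2.1.monotoneOn (vnorm_nonneg _) ((vnorm_nonneg _).trans hle) hle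
  have hc₂ : 0 < c₂ := hc₁.trans hc₁₂
  refine ⟨fun x u w z hcl hx0 t ht => hcl.mem_XN hwmax hN hΔA hΔB hinv (hx0 ▸ hfeas) ht,
    ⟨MPCData.value_one_nonneg hP hR hPN hW0,
      MPCData.continuousOn_value_one hP hR hPN hW0 hX.1 hU.1 hinv hcost,
      _, _, _, _, isClassKInf_mul_sq hc₁, isClassKInf_mul_sq hc₂, isClassKInf_mul_sq hc₁, hσ,
      hbd, ?_⟩, ?_⟩
  · intro s x u w z hs hcl hxs k
    have h1 := hdec s x u w z hs hcl hxs k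
    have h2 := hgain x u w s (le_refl k)
    linarith
  -- Since `V ≤ c₂ ‖x‖²`, the decrease `c₁ ‖x‖²` is at least the fraction `c₁ / c₂` of `V`.
  · set ρ := 1 - c₁ / c₂ with hρ
    have hdiv0 : 0 < c₁ / c₂ := div_pos hc₁ hc₂
    have hdiv1 : c₁ / c₂ < 1 := (div_lt_one hc₂).2 hc₁₂
    have hρ0 : 0 < ρ := by linarith
    have hρ1 : ρ < 1 := by linarith
    have hden : 0 < (1 - ρ) * c₁ := mul_pos (by linarith) hc₁
    have hη1 : √ρ < 1 := by
      rw [Real.sqrt_lt' one_pos]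
      simpa using hρ1
    refine ⟨_, _, isClassKL_mul_rpow (Real.sqrt_pos.2 (div_pos hc₂ hc₁)) (Real.sqrt_pos.2 hρ0) hη1,
      hσ.sqrt_div hden, fun s x u w z hs hcl hxs k => ?_⟩
    have hmem := fun j => hcl.mem_XN_add hwmax hN hΔA hΔB hinv le_rfl hs hxs j
    set ξ := ⨆ i : Fin (k + 1), vnorm p (MPCData.lumped ΔA ΔB x u w (s + i)) with hξ
    have hξ0 : 0 ≤ ξ :=
      (vnorm_nonneg _).trans (MPCData.vnorm_lumped_le_iSup (q := p) ΔA ΔB x u w s (le_refl k))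
    have hε : 0 ≤ b₁ * ξ + b₂ * ξ ^ 2 := hσ.nonneg hξ0
    have hrec : ∀ j < k + 1, D.value p 1 (x (s + (j + 1))) ≤
        ρ * D.value p 1 (x (s + j)) + (b₁ * ξ + b₂ * ξ ^ 2) := by
      intro j hj
      have h1 := hdec s x u w z hs hcl hxs j
      have h2 := hgain x u w s (Nat.le_of_lt_succ hj)
      have h3 : c₁ / c₂ * D.value p 1 (x (s + j)) ≤ c₁ * vnorm p (x (s + j)) ^ 2 := by
        rw [div_mul_eq_mul_div, div_le_iff₀ hc₂, mul_assoc]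
        refine mul_le_mul_of_nonneg_left ?_ hc₁.le
        rw [mul_comm]
        exact (hbd _ (hmem j)).2
      rw [← hξ] at h2
      rw [hρ, sub_mul, one_mul, ← add_assoc s j 1]
      linarith
    have hbound := contraction_bound (V := fun j => D.value p 1 (x (s + j))) hρ0 hρ1 hε hrec
    have hlow := (hbd _ (hmem (k + 1))).1
    have hup := mul_le_mul_of_nonneg_left (hbd _ hxs).2 (pow_nonneg hρ0.le (k + 1))
    have hsq : vnorm p (x (s + k + 1)) ^ 2 ≤
        c₂ / c₁ * vnorm p (x s) ^ 2 * ρ ^ (k + 1) + (b₁ * ξ + b₂ * ξ ^ 2) / ((1 - ρ) * c₁) := by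
      have h : c₁ * vnorm p (x (s + k + 1)) ^ 2 ≤
          ρ ^ (k + 1) * (c₂ * vnorm p (x s) ^ 2) + (b₁ * ξ + b₂ * ξ ^ 2) / (1 - ρ) :=
        hlow.trans (hbound.trans (add_le_add hup le_rfl))
      rw [← le_div_iff₀' hc₁] at h
      refine h.trans (le_of_eq ?_)
      rw [add_div, div_div]
      ring
    have hrpow : √ρ ^ ((k : ℝ) + 1) = √ρ ^ (k + 1) := by
      rw [← Nat.cast_succ, Real.rpow_natCast]
    rw [hrpow]
    have hβ0 : 0 ≤ √(c₂ / c₁) * vnorm p (x s) * √ρ ^ (k + 1) :=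
      mul_nonneg (mul_nonneg (Real.sqrt_nonneg _) (vnorm_nonneg _))
        (pow_nonneg (Real.sqrt_nonneg _) _)
    have hγ0 := Real.sqrt_nonneg ((b₁ * ξ + b₂ * ξ ^ 2) / ((1 - ρ) * c₁))
    -- Subadditivity of the square root in squared form: the bound on the squared norm is the sum of
    -- the squares of the two terms, and their cross term is nonnegative.
    refine (pow_le_pow_iff_left₀ (vnorm_nonneg _) (add_nonneg hβ0 hγ0) two_ne_zero).1 (hsq.trans ?_)
    rw [add_sq, mul_pow, mul_pow, Real.sq_sqrt (div_pos hc₂ hc₁).le, ← pow_mul, mul_comm (k + 1) 2,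
      pow_mul, Real.sq_sqrt hρ0.le, Real.sq_sqrt (div_nonneg hε hden.le)]
    have := mul_nonneg (mul_nonneg zero_le_two hβ0) hγ0
    linarith
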